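/- Let $k$ be a commutative ring and let $r,n\ge 0$ be integers. A ringed space over $k$ is a topological space $S$ with a sheaf $\mathcal O_S$ of commutative $k$-algebras; morphisms are morphisms of ringed spaces compatible with the $k$-algebra structures (no locality condition on the stalks). Let $\Delta_{r,n}$ be the set of subsets with $r$ elements of $\{1,\dots,n\}$. **Algebro-topological quotients.** Let $S$ be a ringed space over $k$. Consider triples $(\mathcal E,\phi,\{U_\delta\}_{\delta\in\Delta_{r,n}})$, where $\mathcal E$ is a sheaf of $\mathcal O_S$-modules, $\phi\colon\mathcal O_S^n\to\mathcal E$ is a morphism of $\mathcal O_S$-modules and each $U_\delta$ is an open subset of $S$. Two triples $(\mathcal E,\phi,\{U_\delta\})$ and $(\mathcal E',\phi',\{U'_\delta\})$ are equivalent if $U_\delta=U'_\delta$ for every $\delta$ and there is an isomorphism $\psi\colon\mathcal E\to\mathcal E'$ with $\psi\circ\phi=\phi'$; the class is denoted $([\mathcal E,\phi],\{U_\delta\})$. A morphism $h\colon T\to S$ induces $h^*([\mathcal E,\phi],\{U_\delta\})=([h^*\mathcal E,h^*\phi],\{h^{-1}(U_\delta)\})$. For $\delta\in\Delta_{r,n}$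 let $\phi_\delta\colon\mathcal O_S^r\to\mathcal E$ be the restriction of $\phi$ to the factors of $\mathcal O_S^n$ with index in $\delta$. An *algebro-topological quotient of rank $r$ of $\mathcal O_S^n$* is a class $([\mathcal E,\phi],\{U_\delta\})$ such that $\mathcal E$ is locally free of rank $r$, $\{U_\delta\}$ is a covering of $S$, and, for every $\delta$, $U_\delta$ is contained in the locus of the points at which $\wedge^r\phi_\delta\colon\mathcal O_S\to\wedge^r\mathcal E$ is an isomorphism on stalks. **The grassmannian ringed space.** Let $\mathcal P^*_{r,n}$ be the finite set of nonempty subsets of $\Delta_{r,n}$, ordered by inclusion, with the topology whose open subsets are the upper sets. A functor from this poset to $k$-algebras is the same as a sheaf of $k$-algebras on $\mathcal P^*_{r,n}$; the value of the functor at $D$ is the stalk of the sheaf at $D$. Let $X=(X_{ij})$ be an $r\times n$ matrix of variables and let $\det_\delta$ be its maximal minor with columns in $\delta$. The space of algebro-topological epimorphisms is $\mathbb E\mathrm{pim}=(\mathcal P^*_{r,n},\mathcal O_{\mathbb E\mathrm{pim}})$, where $\mathcal O_{\mathbb E\mathrm{pim},D}$ is the localization of $k[X_{ij}]$ by the minors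 $\det_\delta$, $\delta\in D$, with the natural morphisms $\mathcal O_{\mathbb E\mathrm{pim},D}\to\mathcal O_{\mathbb E\mathrm{pim},D'}$ for $D\subseteq D'$. The group $\mathrm{GL}_r=(*,k[x_{ij}]_{\det})$ acts on it by $(g,\varphi)\mapsto g\circ\varphi$, that is, through the morphism of sheaves of algebras $\mu\colon\mathcal O_{\mathbb E\mathrm{pim}}\to\mathcal O_{\mathbb E\mathrm{pim}}\otimes_k k[x_{ij}]_{\det}$, $\mu(X_{ij})=\sum_l X_{lj}\otimes x_{il}$. The grassmannian ringed space is the quotient $\mathrm{Grass}_k(r,n)=\mathbb E\mathrm{pim}/\mathrm{GL}_r$: the topological space $\mathcal P^*_{r,n}$ with the sheaf of invariants $\{a\in\mathcal O_{\mathbb E\mathrm{pim}}:\mu(a)=a\otimes1\}$. On $\mathrm{Grass}_k(r,n)$, let $\mathcal Q$ be the sheaf of modules of sections of $(\mathbb E\mathrm{pim}\times\mathbb A^r)/\mathrm{GL}_r$, that is, the sheaf with stalks $\mathcal Q_D=\{v\in\mathcal O_{\mathbb E\mathrm{pim},D}^r:\mu(v_i)=\sum_j v_j\otimes x_{ij}\text{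 for all }i\}$; let $\overline\Phi\colon\mathcal O^n_{\mathrm{Grass}_k(r,n)}\to\mathcal Q$ be the morphism that sends the $j$-th vector of the standard basis to the $j$-th column of $X$; and let $U_{\{\delta\}}=\{D\in\mathcal P^*_{r,n}:\delta\in D\}$. **Theorem.** The inverse image $h^*\theta$ of an algebro-topological quotient $\theta$ of rank $r$ of $\mathcal O_S^n$ along a morphism $h\colon T\to S$ of ringed spaces over $k$ is an algebro-topological quotient of rank $r$ of $\mathcal O_T^n$. The class $u=([\mathcal Q,\overline\Phi],\{U_{\{\delta\}}\}_{\delta\in\Delta_{r,n}})$ is an algebro-topological quotient of rank $r$ of $\mathcal O^n_{\mathrm{Grass}_k(r,n)}$, and $\mathrm{Grass}_k(r,n)$ represents the functor of algebro-topological quotients of rank $r$ of the free module of rank $n$, with universal object $u$: for every ringed space $S$ over $k$ the map $$\operatorname{Hom}_k(S,\mathrm{Grass}_k(r,n))\longrightarrow\{\text{algebro-topological quotients of rank } r\text{ of }\mathcal O_S^n\},\qquad h\mapsto h^*u,$$ is bijective (and it is natural in $S$). -/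

import Mathlib

open CategoryTheory TopologicalSpace Opposite AlgebraicGeometry
open scoped TensorProduct
universe u
noncomputable section
namespace GrassRS

/-- A ringed space over `k`: a topological space with a sheaf of commutative `k`-algebras. Since
`k` is a constant ring, the `k`-algebra structure on the sheaf is the same as a ring homomorphism
from `k` to the ring of global sections. -/
structure RingedSpaceOver (k : Type u) [CommRing k] where
  toRingedSpace : RingedSpace.{u, u}
  structureMap : k →+* toRingedSpace.presheaf.obj (op ⊤)

namespace RingedSpaceOver
variable {k : Type u} [CommRing k]

/-- A morphism of ringed spaces over `k`: a continuous map with a morphism of sheaves of rings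
`O_T ⟶ h_* O_S` that is compatible with the structure maps from `k`. No locality is required. -/
@[ext]
structure Hom (S T : RingedSpaceOver k) where
  hom : S.toRingedSpace ⟶ T.toRingedSpace
  comm : ∀ a : k, (hom.hom.c.app (op ⊤)).hom (T.structureMap a) = S.structureMap a

instance : Category (RingedSpaceOver k) where
  Hom S T := Hom S T
  id S := { hom := 𝟙 _, comm := fun a => by rw [SheafedSpace.id_hom_c_app]; rfl }
  comp f g := {
    hom := f.hom ≫ g.hom
    comm := fun a => by
      have h := f.comm a
      rw [← g.comm a] at h
      exact h }

/-- The underlying topological space. -/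
abbrev space (S : RingedSpaceOver k) : TopCat.{u} := S.toRingedSpace.carrier

/-- The structure sheaf, as a sheaf of rings in the form used by `SheafOfModules`. -/
abbrev ringSheaf (S : RingedSpaceOver k) :
    Sheaf (Opens.grothendieckTopology S.space) RingCat.{u} :=
  ⟨S.toRingedSpace.presheaf ⋙ forget₂ CommRingCat RingCat.{u},
    ((sheafCompose _ (forget₂ CommRingCat RingCat.{u})).obj
      ⟨S.toRingedSpace.presheaf, S.toRingedSpace.IsSheaf⟩).property⟩

/-- The category of sheaves of `O_S`-modules. -/
abbrev Modules (S : RingedSpaceOver k) := SheafOfModules.{u} S.ringSheaf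

variable {S T : RingedSpaceOver k}

/-- The continuous map underlying a morphism. -/
def base (h : S ⟶ T) : S.space ⟶ T.space := (Hom.hom h).hom.base

/-- The morphism of sheaves of rings `O_T ⟶ h_* O_S` underlying a morphism. -/
def ringMap (h : S ⟶ T) :
    T.ringSheaf ⟶ ((Opens.map (base h)).sheafPushforwardContinuous RingCat.{u} _ _).obj
      S.ringSheaf where
  hom := Functor.whiskerRight (Hom.hom h).hom.c (forget₂ CommRingCat RingCat.{u})

/-- The direct image `h_*` of sheaves of modules. -/
def pushforward (h : S ⟶ T) : S.Modules ⥤ T.Modules :=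
  SheafOfModules.pushforward.{u} (ringMap h)

instance (h : S ⟶ T) : (SheafOfModules.pushforward.{u} (ringMap h)).IsRightAdjoint :=
  have := PresheafOfModules.instIsRightAdjointPushforward (C := Opens T.space)
    (D := Opens S.space) (F := Opens.map (base h)) (R := S.ringSheaf.obj) (S := T.ringSheaf.obj)
    (ringMap h).hom
  have : (PresheafOfModules.pushforward.{u} (ringMap h).hom).IsRightAdjoint := this
  SheafOfModules.instIsRightAdjointPushforward (ringMap h)

/-- The inverse image `h^*` of sheaves of modules: the left adjoint of `h_*`, that is,
`h⁻¹ E ⊗ O_S` over `h⁻¹ O_T`. -/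
def pullback (h : S ⟶ T) : T.Modules ⥤ S.Modules :=
  SheafOfModules.pullback.{u} (ringMap h)

/-- The adjunction between `h^*` and `h_*`. -/
def pullbackPushforwardAdj (h : S ⟶ T) : pullback h ⊣ pushforward h :=
  SheafOfModules.pullbackPushforwardAdjunction.{u} (ringMap h)

/-- The module of global sections of a sheaf of modules. -/
abbrev globalSections (E : S.Modules) : Type u := E.val.obj (op ⊤)

/-- The global section `h^* s` of `h^* E` defined by a global section `s` of `E`. -/
def pullbackSection (h : S ⟶ T) {E : T.Modules} (s : globalSections E) :
    globalSections ((pullback h).obj E) :=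
  (((pullbackPushforwardAdj h).unit.app E).val.app (op ⊤)).hom s

/-- Direct image along the identity is the identity. -/
def pushforwardIdIso (S : RingedSpaceOver k) : pushforward (𝟙 S) ≅ 𝟭 S.Modules :=
  Iso.refl (𝟭 S.Modules)

/-- Direct image is functorial in the morphism of ringed spaces. -/
def pushforwardCompIso {R : RingedSpaceOver k} (f : R ⟶ S) (g : S ⟶ T) :
    pushforward f ⋙ pushforward g ≅ pushforward (f ≫ g) :=
  Iso.refl (pushforward f ⋙ pushforward g)

/-- The stalk of the structure sheaf at a point. -/
abbrev stalkRing (S : RingedSpaceOver k) (x : S.space) : CommRingCat.{u} :=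
  S.toRingedSpace.presheaf.stalk x

/-- The stalk of a sheaf of modules at a point, a module over the stalk of the structure sheaf. -/
abbrev stalkModule (E : S.Modules) (x : S.space) : Ab.{u} :=
  TopCat.Presheaf.stalk (C := Ab.{u}) (X := S.space) E.val.presheaf x

/-- The germ at `x` of a global section. -/
def germ (E : S.Modules) (x : S.space) (s : globalSections E) : stalkModule E x :=
  (TopCat.Presheaf.germ (C := Ab.{u}) (X := S.space) E.val.presheaf ⊤ x trivial).hom s

/-- For global sections `s_1, ..., s_r` of `E`, the germ at `x` of `s_1 ∧ ... ∧ s_r`, as an element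
of the exterior power `⋀^r E_x`, which is the stalk at `x` of the sheaf `⋀^r E`. -/
def wedgeGerm {r : ℕ} (E : S.Modules) (x : S.space) (s : Fin r → globalSections E) :
    ⋀[stalkRing S x]^r (stalkModule E x) :=
  exteriorPower.ιMulti (stalkRing S x) r (fun i => germ E x (s i))

/-- The locus of the points `x` at which the morphism `O_S ⟶ ⋀^r E` given by the section
`s_1 ∧ ... ∧ s_r` is an isomorphism on stalks. If `φ_δ : O_S^r ⟶ E` is the morphism with components
`s_1, ..., s_r`, this is the locus where `⋀^r φ_δ` is an isomorphism. -/
def wedgeLocus {r : ℕ} (E : S.Modules) (s : Fin r → globalSections E) : Set S.space :=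
  {x | Function.Bijective (fun a : stalkRing S x => a • wedgeGerm E x s)}

/-- `E` is locally free of rank `r`: every point has an open neighbourhood `U` on which there are
`r` sections of `E` that form a basis of the sections of `E` on every open `V ≤ U`; in other words,
they define an isomorphism of `O_U^r` with the restriction of `E` to `U`. -/
def IsLocallyFreeOfRank (E : S.Modules) (r : ℕ) : Prop :=
  ∀ x : S.space, ∃ U : Opens S.space, x ∈ U ∧ ∃ e : Fin r → E.val.obj (op U),
    ∀ (V : Opens S.space) (hV : V ≤ U), Function.Bijective
      (fun a : Fin r → S.toRingedSpace.presheaf.obj (op V) =>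
        (∑ i, a i • (E.val.map (homOfLE hV).op).hom (e i) : E.val.obj (op V)))

end RingedSpaceOver

open RingedSpaceOver

/-- The set of the subsets with `r` elements of a set with `n` elements. -/
abbrev RSubset (r n : ℕ) : Type := {δ : Finset (Fin n) // δ.card = r}

/-- The increasing enumeration of an `r`-subset. -/
def RSubset.emb {r n : ℕ} (δ : RSubset r n) : Fin r ↪o Fin n := δ.1.orderEmbOfFin δ.2

variable {k : Type u} [CommRing k]

/-- A sheaf of modules `E` with a morphism `φ : O_S^n ⟶ E`, given by the `n` global sections of `E`
that are the images of the standard basis, and a family of open subsets of `S` indexed by the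
`r`-subsets of `{1, ..., n}`. -/
structure QuotientDatum (r n : ℕ) (S : RingedSpaceOver k) where
  E : S.Modules
  φ : Fin n → globalSections E
  U : RSubset r n → Opens S.space

namespace QuotientDatum
variable {r n : ℕ} {S T : RingedSpaceOver k}

/-- The conditions under which the datum defines an algebro-topological quotient of rank `r` of
`O_S^n`: `E` is locally free of rank `r`, the open sets `U_δ` cover `S`, and `U_δ` is contained in
the locus on which `⋀^r φ_δ` is an isomorphism. -/
structure IsAlgTopQuotient (θ : QuotientDatum r n S) : Prop where
  locallyFree : IsLocallyFreeOfRank θ.E r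
  covers : ∀ x : S.space, ∃ δ, x ∈ θ.U δ
  subset_locus : ∀ δ, (θ.U δ : Set S.space) ⊆ wedgeLocus θ.E (fun i => θ.φ (δ.emb i))

/-- Two data are equivalent if the open subsets are the same and there is an isomorphism `ψ` of
sheaves of modules whose composition with the first morphism from `O_S^n` is the second one. The
class of a datum is the couple `([E, φ], {U_δ})`. -/
def Equivalent (θ θ' : QuotientDatum r n S) : Prop :=
  θ.U = θ'.U ∧ ∃ ψ : θ.E ≅ θ'.E, ∀ i, (ψ.hom.val.app (op ⊤)).hom (θ.φ i) = θ'.φ i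

instance setoid (r n : ℕ) (S : RingedSpaceOver k) : Setoid (QuotientDatum r n S) where
  r := Equivalent
  iseqv :=
    { refl := fun θ => ⟨rfl, Iso.refl _, fun i => rfl⟩
      symm := by
        rintro θ θ' ⟨hU, ψ, h⟩
        refine ⟨hU.symm, ψ.symm, fun i => ?_⟩
        rw [← h i]
        have := congrArg (fun f => (f.val.app (op ⊤)).hom (θ.φ i)) ψ.hom_inv_id
        exact this
      trans := by
        rintro θ θ' θ'' ⟨hU, ψ, h⟩ ⟨hU', ψ', h'⟩
        refine ⟨hU.trans hU', ψ ≪≫ ψ', fun i => ?_⟩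
        rw [← h' i, ← h i]
        rfl }

/-- The inverse image of a datum: `(h^* E, h^* φ, {h⁻¹ U_δ})`. -/
def pullback (h : S ⟶ T) (θ : QuotientDatum r n T) : QuotientDatum r n S where
  E := (RingedSpaceOver.pullback h).obj θ.E
  φ := fun i => pullbackSection h (θ.φ i)
  U := fun δ => (Opens.map (base h)).obj (θ.U δ)

theorem pullback_equivalent (h : S ⟶ T) {θ θ' : QuotientDatum r n T} (e : Equivalent θ θ') :
    Equivalent (θ.pullback h) (θ'.pullback h) := by
  obtain ⟨hU, ψ, hψ⟩ := e
  refine ⟨by simp only [pullback, hU], (RingedSpaceOver.pullback h).mapIso ψ, fun i => ?_⟩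
  have := congrArg (fun f => (f.val.app (op ⊤)).hom (θ.φ i))
    ((pullbackPushforwardAdj h).unit.naturality ψ.hom)
  refine Eq.trans this.symm ?_
  simp only [pullback, ← hψ]
  rfl

theorem pullback_id (θ : QuotientDatum r n S) : Equivalent (θ.pullback (𝟙 S)) θ := by
  let a := (pullbackPushforwardAdj (𝟙 S)).ofNatIsoRight (pushforwardIdIso S)
  refine ⟨rfl, (Adjunction.leftAdjointUniq a Adjunction.id).app θ.E, fun i => ?_⟩
  have := congrArg (fun f => (f.val.app (op ⊤)).hom (θ.φ i))
    (Adjunction.unit_leftAdjointUniq_hom_app a Adjunction.id θ.E)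
  exact this

theorem pullback_comp {R : RingedSpaceOver k} (f : R ⟶ S) (g : S ⟶ T) (θ : QuotientDatum r n T) :
    Equivalent (θ.pullback (f ≫ g)) ((θ.pullback g).pullback f) := by
  let a := ((pullbackPushforwardAdj g).comp (pullbackPushforwardAdj f)).ofNatIsoRight
    (pushforwardCompIso f g)
  refine ⟨rfl, (Adjunction.leftAdjointUniq (pullbackPushforwardAdj (f ≫ g)) a).app θ.E,
    fun i => ?_⟩
  have := congrArg (fun f => (f.val.app (op ⊤)).hom (θ.φ i))
    (Adjunction.unit_leftAdjointUniq_hom_app (pullbackPushforwardAdj (f ≫ g)) a θ.E)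
  exact this

end QuotientDatum

/-- The contravariant functor that sends a ringed space `S` over `k` to the set of the classes
`([E, φ], {U_δ})` of data on `S`, and a morphism `h` to `h^*`. -/
def datumFunctor (k : Type u) [CommRing k] (r n : ℕ) : (RingedSpaceOver k)ᵒᵖ ⥤ Type (u + 1) where
  obj S := Quotient (QuotientDatum.setoid r n S.unop)
  map {S T} h := ↾(Quotient.map (QuotientDatum.pullback h.unop)
    (fun _ _ e => QuotientDatum.pullback_equivalent h.unop e))
  map_id S := by
    ext c
    induction c using Quotient.inductionOn with
    | h θ => exact Quotient.sound (QuotientDatum.pullback_id θ)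
  map_comp f g := by
    ext c
    induction c using Quotient.inductionOn with
    | h θ => exact Quotient.sound (QuotientDatum.pullback_comp g.unop f.unop θ)

/-- The set of the nonempty sets of `r`-subsets of `{1, ..., n}`. -/
@[ext]
structure PStar (r n : ℕ) : Type u where
  parts : Set (RSubset r n)
  nonempty : parts.Nonempty

namespace PStar
variable {r n : ℕ}

/-- It is partially ordered by inclusion. -/
instance : PartialOrder (PStar.{u} r n) :=
  PartialOrder.lift PStar.parts (fun _ _ h => PStar.ext h)

/-- Its topology is the one associated to the order: the open subsets are the upper sets. -/
instance : TopologicalSpace (PStar.{u} r n) := Topology.upperSet _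

instance : Topology.IsUpperSet (PStar.{u} r n) := ⟨rfl⟩

/-- The open subset of those `D` with `δ ∈ D`. -/
def basicOpen (δ : RSubset r n) : Opens (PStar.{u} r n) where
  carrier := {D | δ ∈ D.parts}
  is_open' := Topology.IsUpperSet.isOpen_iff_isUpperSet.mpr fun _ _ h hδ => h hδ

end PStar

section Epim
variable (k) (r n : ℕ)

/-- The polynomial ring over `k` in the `r × n` variables `X_ij`. -/
abbrev HomRing : Type u := MvPolynomial (Fin r × Fin n) k

variable {r n} in
/-- The maximal minor `det_δ` of the generic `r × n` matrix `X`, with columns in `δ`. -/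
def minor (δ : RSubset r n) : HomRing k r n :=
  ((Matrix.mvPolynomialX (Fin r) (Fin n) k).submatrix id δ.emb).det

variable {r n} in
/-- The multiplicative set generated by the minors `det_δ` with `δ ∈ D`. -/
def minors (D : Set (RSubset r n)) : Submonoid (HomRing k r n) :=
  Submonoid.closure (minor k '' D)

variable {r n} in
/-- The stalk at `D` of the structure sheaf of the space of algebro-topological epimorphisms: the
localization of the polynomial ring by the minors `det_δ` with `δ ∈ D`. -/
def EpimRing (D : Set (RSubset r n)) : Type u := Localization (minors k D)

variable {r n} in
instance (D : Set (RSubset r n)) : CommRing (EpimRing k D) :=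
  inferInstanceAs (CommRing (Localization (minors k D)))

variable {r n} in
instance (D : Set (RSubset r n)) : Algebra (HomRing k r n) (EpimRing k D) :=
  inferInstanceAs (Algebra (HomRing k r n) (Localization (minors k D)))

variable {r n} in
instance (D : Set (RSubset r n)) : Algebra k (EpimRing k D) :=
  inferInstanceAs (Algebra k (Localization (minors k D)))

variable {r n} in
instance (D : Set (RSubset r n)) : IsScalarTower k (HomRing k r n) (EpimRing k D) :=
  inferInstanceAs (IsScalarTower k (HomRing k r n) (Localization (minors k D)))

variable {r n} in
instance (D : Set (RSubset r n)) : IsLocalization (minors k D) (EpimRing k D) :=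
  inferInstanceAs (IsLocalization (minors k D) (Localization (minors k D)))

variable {r n} in
/-- The natural morphism between localizations, when the set of minors grows. -/
def EpimRing.res {D D' : Set (RSubset r n)} (h : D ⊆ D') : EpimRing k D →ₐ[k] EpimRing k D' :=
  IsLocalization.liftAlgHom (M := minors k D)
    (f := IsScalarTower.toAlgHom k (HomRing k r n) (EpimRing k D'))
    (fun y => IsLocalization.map_units (EpimRing k D')
      (⟨y, Submonoid.closure_mono (Set.image_mono h) y.2⟩ : minors k D'))

variable {k r n} in
theorem EpimRing.res_algebraMap {D D' : Set (RSubset r n)} (h : D ⊆ D') (p : HomRing k r n) :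
    EpimRing.res k h (algebraMap _ _ p) = algebraMap _ _ p := by
  exact IsLocalization.lift_eq _ _

variable {k r n} in
theorem EpimRing.algHom_ext {D : Set (RSubset r n)} {B : Type*} [CommRing B] [Algebra k B]
    {f g : EpimRing k D →ₐ[k] B}
    (h : ∀ p : Fin r × Fin n, f (algebraMap (HomRing k r n) _ (MvPolynomial.X p)) =
      g (algebraMap (HomRing k r n) _ (MvPolynomial.X p))) : f = g := by
  have h1 : f.comp (IsScalarTower.toAlgHom k (HomRing k r n) (EpimRing k D)) =
      g.comp (IsScalarTower.toAlgHom k (HomRing k r n) (EpimRing k D)) :=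
    MvPolynomial.algHom_ext h
  have h2 : (f : EpimRing k D →+* B) = g :=
    IsLocalization.ringHom_ext (minors k D)
      (RingHom.ext fun x => DFunLike.congr_fun h1 x)
  exact AlgHom.ext fun x => DFunLike.congr_fun h2 x

/-- The localizations `EpimRing D` as a functor on the poset. -/
def epimFunctor : PStar.{u} r n ⥤ CommAlgCat.{u} k where
  obj D := CommAlgCat.of k (EpimRing k D.parts)
  map f := CommAlgCat.ofHom (EpimRing.res k f.le)
  map_id D := by
    ext1
    exact EpimRing.algHom_ext fun p => EpimRing.res_algebraMap (le_refl D.parts) _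
  map_comp f g := by
    ext1
    refine EpimRing.algHom_ext fun p => ?_
    simp [EpimRing.res_algebraMap]

/-- The coordinate ring `k[x_ij]_det` of `GL_r`. -/
def GLRing : Type u := Localization.Away (Matrix.mvPolynomialX (Fin r) (Fin r) k).det

instance : CommRing (GLRing k r) :=
  inferInstanceAs (CommRing (Localization.Away (Matrix.mvPolynomialX (Fin r) (Fin r) k).det))

instance : Algebra k (GLRing k r) :=
  inferInstanceAs (Algebra k (Localization.Away (Matrix.mvPolynomialX (Fin r) (Fin r) k).det))

instance : Algebra (MvPolynomial (Fin r × Fin r) k) (GLRing k r) :=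
  inferInstanceAs (Algebra (MvPolynomial (Fin r × Fin r) k)
    (Localization.Away (Matrix.mvPolynomialX (Fin r) (Fin r) k).det))

instance : IsLocalization.Away (Matrix.mvPolynomialX (Fin r) (Fin r) k).det (GLRing k r) :=
  inferInstanceAs (IsLocalization.Away (Matrix.mvPolynomialX (Fin r) (Fin r) k).det
    (Localization.Away (Matrix.mvPolynomialX (Fin r) (Fin r) k).det))

/-- The generic invertible matrix `(x_ij)`. -/
def GLRing.gen : Matrix (Fin r) (Fin r) (GLRing k r) :=
  (Matrix.mvPolynomialX (Fin r) (Fin r) k).map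
    (algebraMap (MvPolynomial (Fin r × Fin r) k) (GLRing k r))

variable {r n} in
/-- The morphism of algebras with `X_ij ↦ ∑_l X_lj ⊗ x_il`, on the polynomial ring. -/
def coactPoly (D : Set (RSubset r n)) : HomRing k r n →ₐ[k] EpimRing k D ⊗[k] GLRing k r :=
  MvPolynomial.aeval fun p =>
    ∑ l, algebraMap (HomRing k r n) (EpimRing k D) (MvPolynomial.X (l, p.2)) ⊗ₜ[k]
      GLRing.gen k r p.1 l

theorem GLRing.isUnit_det : IsUnit (GLRing.gen k r).det := by
  have h : (GLRing.gen k r).det =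
      algebraMap _ (GLRing k r) (Matrix.mvPolynomialX (Fin r) (Fin r) k).det := by
    rw [RingHom.map_det]; rfl
  rw [h]
  exact IsLocalization.Away.algebraMap_isUnit _

variable {r n} in
theorem coactPoly_minor (D : Set (RSubset r n)) (δ : RSubset r n) :
    coactPoly k D (minor k δ) =
      algebraMap (HomRing k r n) (EpimRing k D) (minor k δ) ⊗ₜ[k] (GLRing.gen k r).det := by
  let a : EpimRing k D →ₐ[k] EpimRing k D ⊗[k] GLRing k r := Algebra.TensorProduct.includeLeft
  let b : GLRing k r →ₐ[k] EpimRing k D ⊗[k] GLRing k r := Algebra.TensorProduct.includeRight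
  have h1 : ((Matrix.mvPolynomialX (Fin r) (Fin n) k).submatrix id δ.emb).map (coactPoly k D) =
      (GLRing.gen k r).map b *
        (((Matrix.mvPolynomialX (Fin r) (Fin n) k).submatrix id δ.emb).map
          (algebraMap (HomRing k r n) (EpimRing k D))).map a := by
    ext i j
    simp [coactPoly, Matrix.mul_apply, a, b]
  have h2 : coactPoly k D ((Matrix.mvPolynomialX (Fin r) (Fin n) k).submatrix id δ.emb).det =
      (((Matrix.mvPolynomialX (Fin r) (Fin n) k).submatrix id δ.emb).map (coactPoly k D)).det :=
    RingHom.map_det (coactPoly k D : HomRing k r n →+* EpimRing k D ⊗[k] GLRing k r)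
      ((Matrix.mvPolynomialX (Fin r) (Fin n) k).submatrix id δ.emb)
  have h3 := AlgHom.map_det b (GLRing.gen k r)
  have h4 := AlgHom.map_det a (((Matrix.mvPolynomialX (Fin r) (Fin n) k).submatrix id δ.emb).map
          (algebraMap (HomRing k r n) (EpimRing k D)))
  have h5 := RingHom.map_det (algebraMap (HomRing k r n) (EpimRing k D))
    ((Matrix.mvPolynomialX (Fin r) (Fin n) k).submatrix id δ.emb)
  simp only [AlgHom.mapMatrix_apply, RingHom.mapMatrix_apply] at h3 h4 h5
  rw [minor, h2, h1, Matrix.det_mul, ← h3, ← h4, ← h5]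
  simp [a, b]

variable {r n} in
theorem isUnit_coactPoly (D : Set (RSubset r n)) (y : minors k D) :
    IsUnit (coactPoly k D y) := by
  obtain ⟨y, hy⟩ := y
  have : minors k D ≤ (IsUnit.submonoid (EpimRing k D ⊗[k] GLRing k r)).comap
      (coactPoly k D : HomRing k r n →* EpimRing k D ⊗[k] GLRing k r) := by
    refine Submonoid.closure_le.mpr ?_
    rintro _ ⟨δ, hδ, rfl⟩
    change IsUnit (coactPoly k D (minor k δ))
    have h1 : IsUnit (algebraMap (HomRing k r n) (EpimRing k D) (minor k δ)) :=
      IsLocalization.map_units (EpimRing k D)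
        (⟨_, Submonoid.subset_closure ⟨δ, hδ, rfl⟩⟩ : minors k D)
    have h2 := (h1.map (Algebra.TensorProduct.includeLeft :
      EpimRing k D →ₐ[k] EpimRing k D ⊗[k] GLRing k r)).mul
      ((GLRing.isUnit_det k r).map (Algebra.TensorProduct.includeRight :
        GLRing k r →ₐ[k] EpimRing k D ⊗[k] GLRing k r))
    rw [coactPoly_minor]
    simpa using h2
  exact this hy

variable {r n} in
/-- The morphism of algebras `O ⟶ O ⊗ k[x_ij]_det` with `X_ij ↦ ∑_l X_lj ⊗ x_il`, at `D`. It
corresponds to the action `(g, φ) ↦ g ∘ φ` of `GL_r` on epimorphisms. -/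
def coact (D : Set (RSubset r n)) : EpimRing k D →ₐ[k] EpimRing k D ⊗[k] GLRing k r :=
  IsLocalization.liftAlgHom (M := minors k D) (f := coactPoly k D) (isUnit_coactPoly k D)

variable {k r n} in
theorem coact_algebraMap (D : Set (RSubset r n)) (p : HomRing k r n) :
    coact k D (algebraMap _ _ p) = coactPoly k D p :=
  IsLocalization.lift_eq _ _

variable {k r n} in
theorem coact_res {D D' : Set (RSubset r n)} (h : D ⊆ D') (a : EpimRing k D) :
    coact k D' (EpimRing.res k h a) =
      Algebra.TensorProduct.map (EpimRing.res k h) (AlgHom.id k (GLRing k r)) (coact k D a) := by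
  have : (coact k D').comp (EpimRing.res k h) =
      (Algebra.TensorProduct.map (EpimRing.res k h) (AlgHom.id k (GLRing k r))).comp
        (coact k D) := by
    refine EpimRing.algHom_ext fun p => ?_
    simp [coact, EpimRing.res_algebraMap, coactPoly]
  exact DFunLike.congr_fun this a

variable {r n} in
/-- The ring of invariants at `D`: the kernel of the difference of the coaction and `a ↦ a ⊗ 1`. -/
def invariants (D : Set (RSubset r n)) : Subalgebra k (EpimRing k D) :=
  AlgHom.equalizer (coact k D) Algebra.TensorProduct.includeLeft

variable {r n} in
/-- The restriction of invariants, when `D` grows. -/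
def invariants.res {D D' : Set (RSubset r n)} (h : D ⊆ D') :
    invariants k D →ₐ[k] invariants k D' :=
  ((EpimRing.res k h).comp (invariants k D).val).codRestrict (invariants k D') fun a => by
    have ha : coact k D a = (a : EpimRing k D) ⊗ₜ[k] 1 := a.2
    change coact k D' (EpimRing.res k h a) = EpimRing.res k h a ⊗ₜ[k] 1
    rw [coact_res, ha]
    simp

/-- The rings of invariants as a functor on the poset. -/
def grassFunctor : PStar.{u} r n ⥤ CommAlgCat.{u} k where
  obj D := CommAlgCat.of k (invariants k D.parts)
  map f := CommAlgCat.ofHom (invariants.res k f.le)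
  map_id D := by
    ext1
    exact AlgHom.ext fun a => Subtype.ext (congrArg (fun f => f.hom a.1) ((epimFunctor k r n).map_id D))
  map_comp f g := by
    ext1
    exact AlgHom.ext fun a => Subtype.ext
      (congrArg (fun f => f.hom a.1) ((epimFunctor k r n).map_comp f g))

variable {r n} in
/-- The vectors `v` with entries in `EpimRing D` that are equivariant: the coaction sends `v_i` to
`∑_j v_j ⊗ x_ij`, which says `v (g ∘ φ) = g (v φ)`. They are the sections of the quotient of
`Epim × 𝔸^r` by `GL_r`, over the quotient of `Epim` by `GL_r`, at `D`. -/
def equivariantVectors (D : Set (RSubset r n)) :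
    Submodule (invariants k D) (Fin r → EpimRing k D) where
  carrier := {v | ∀ i, coact k D (v i) = ∑ j, v j ⊗ₜ[k] GLRing.gen k r i j}
  zero_mem' := fun i => by simp
  add_mem' := fun {v w} hv hw i => by
    simp only [Pi.add_apply, map_add, hv i, hw i, TensorProduct.add_tmul, Finset.sum_add_distrib]
  smul_mem' := fun a v hv i => by
    have ha : coact k D a = (a : EpimRing k D) ⊗ₜ[k] 1 := a.2
    change coact k D ((a : EpimRing k D) * v i) =
      ∑ j, ((a : EpimRing k D) * v j) ⊗ₜ[k] GLRing.gen k r i j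
    rw [map_mul, hv i, ha, Finset.mul_sum]
    simp

end Epim

section Poset

variable {X : Type u} [Preorder X] [TopologicalSpace X] [Topology.IsUpperSet X]

/-- For a functor `A` on a poset, the families of elements of the `A x`, for `x` in an open subset,
that are compatible with the transition maps. This is how a functor on a poset is viewed as a sheaf;
its stalk at `x` is `A x`. -/
def compatible (A : X ⥤ Type u) : TopCat.LocalPredicate (X := TopCat.of X) (fun x => A.obj x) where
  pred {U} s := ∀ (x y : U) (h : x.1 ≤ y.1), A.map (homOfLE h) (s x) = s y
  res i s hs x y h := hs ⟨x.1, i.le x.2⟩ ⟨y.1, i.le y.2⟩ h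
  locality {U} s hs x y h := by
    obtain ⟨V, hxV, i, hV⟩ := hs x
    have hyV : y.1 ∈ V := Topology.IsUpperSet.isOpen_iff_isUpperSet.mp V.isOpen h hxV
    exact hV ⟨x.1, hxV⟩ ⟨y.1, hyV⟩ h

/-- The algebra of sections on an open subset of the sheaf given by a functor `A`. -/
def ringSections (A : X ⥤ CommAlgCat.{u} k) (U : Opens (TopCat.of X)) :
    Subalgebra k (∀ x : U, A.obj x.1) where
  carrier := {s | (compatible (A ⋙ forget _)).pred s}
  mul_mem' {s t} hs ht x y h := by
    have hs' : (A.map (homOfLE h)).hom (s x) = s y := hs x y h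
    have ht' : (A.map (homOfLE h)).hom (t x) = t y := ht x y h
    change (A.map (homOfLE h)).hom (s x * t x) = s y * t y
    rw [map_mul, hs', ht']
  add_mem' {s t} hs ht x y h := by
    have hs' : (A.map (homOfLE h)).hom (s x) = s y := hs x y h
    have ht' : (A.map (homOfLE h)).hom (t x) = t y := ht x y h
    change (A.map (homOfLE h)).hom (s x + t x) = s y + t y
    rw [map_add, hs', ht']
  algebraMap_mem' a x y h := (A.map (homOfLE h)).hom.commutes a

/-- The presheaf of rings given by a functor `A`. -/
def posetPresheaf (A : X ⥤ CommAlgCat.{u} k) : TopCat.Presheaf CommRingCat.{u} (TopCat.of X) where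
  obj U := CommRingCat.of (ringSections A U.unop)
  map {U V} i := CommRingCat.ofHom
    { toFun := fun s => ⟨fun x => s.1 ⟨x.1, i.unop.le x.2⟩,
        (compatible (A ⋙ forget _)).res i.unop _ s.2⟩
      map_one' := rfl
      map_mul' := fun _ _ => rfl
      map_zero' := rfl
      map_add' := fun _ _ => rfl }

theorem posetPresheaf_isSheaf (A : X ⥤ CommAlgCat.{u} k) : (posetPresheaf A).IsSheaf := by
  rw [TopCat.Presheaf.isSheaf_iff_isSheaf_comp (forget CommRingCat)]
  refine TopCat.Presheaf.isSheaf_of_iso (F := TopCat.subpresheafToTypes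
      (compatible (A ⋙ forget (CommAlgCat.{u} k))).toPrelocalPredicate)
    (NatIso.ofComponents (fun _ => Equiv.toIso (Equiv.refl _)) ?_)
    (TopCat.subpresheafToTypes.isSheaf (compatible (A ⋙ forget (CommAlgCat.{u} k))))
  intros
  rfl

/-- The ringed space over `k` given by a poset, with the topology of upper sets, and a functor from
it to `k`-algebras. -/
def ofPoset (A : X ⥤ CommAlgCat.{u} k) : RingedSpaceOver k where
  toRingedSpace := { carrier := TopCat.of X, presheaf := posetPresheaf A,
                     IsSheaf := posetPresheaf_isSheaf A }
  structureMap := (algebraMap k (ringSections A ⊤) : k →+* ringSections A ⊤)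

end Poset

/-- The space of algebro-topological epimorphisms from the free module of rank `n` to the free module
of rank `r`. -/
def Epim (k : Type u) [CommRing k] (r n : ℕ) : RingedSpaceOver k := ofPoset (epimFunctor k r n)

/-- The grassmannian ringed space: the quotient of `Epim` by `GL_r`, that is, the same underlying
space with the sheaf of the invariants of the structure sheaf. -/
def Grass (k : Type u) [CommRing k] (r n : ℕ) : RingedSpaceOver k := ofPoset (grassFunctor k r n)

section Universal
variable (k) (r n : ℕ)

variable {r n} in
/-- The restriction of equivariant vectors, when `D` grows. -/
def equivariantVectors.res {D D' : Set (RSubset r n)} (h : D ⊆ D') :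
    equivariantVectors k D →+ equivariantVectors k D' where
  toFun v := ⟨fun i => EpimRing.res k h (v.1 i), fun i => by
    have hv : coact k D (v.1 i) = ∑ j, v.1 j ⊗ₜ[k] GLRing.gen k r i j := v.2 i
    change coact k D' (EpimRing.res k h (v.1 i)) =
      ∑ j, EpimRing.res k h (v.1 j) ⊗ₜ[k] GLRing.gen k r i j
    rw [coact_res, hv, map_sum]
    simp⟩
  map_zero' := Subtype.ext (funext fun i => map_zero (EpimRing.res k h))
  map_add' v w := Subtype.ext (funext fun i => map_add (EpimRing.res k h) (v.1 i) (w.1 i))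

variable {k r n} in
theorem equivariantVectors.res_smul {D D' : Set (RSubset r n)} (h : D ⊆ D')
    (a : invariants k D) (v : equivariantVectors k D) :
    equivariantVectors.res k h (a • v) = invariants.res k h a • equivariantVectors.res k h v :=
  Subtype.ext (funext fun i => map_mul (EpimRing.res k h) a.1 (v.1 i))

/-- The equivariant vectors as a functor on the poset. -/
def bundleFunctor : PStar.{u} r n ⥤ Type u where
  obj D := equivariantVectors k D.parts
  map f := ↾(equivariantVectors.res k f.le)
  map_id D := by
    refine ConcreteCategory.hom_ext _ _ fun v => ?_
    exact Subtype.ext (funext fun i =>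
      congrArg (fun f => f.hom (v.1 i)) ((epimFunctor k r n).map_id D))
  map_comp f g := by
    refine ConcreteCategory.hom_ext _ _ fun v => ?_
    exact Subtype.ext (funext fun i =>
      congrArg (fun h => h.hom (v.1 i)) ((epimFunctor k r n).map_comp f g))

variable {r n} in
/-- The sections of the structure sheaf of the grassmannian. -/
abbrev GrassSections (U : Opens (TopCat.of (PStar.{u} r n))) : Type u :=
  ringSections (grassFunctor k r n) U

variable {k r n} in
/-- The value at `D`, an invariant, of a section of the structure sheaf of the grassmannian. -/
def GrassSections.value {U : Opens (TopCat.of (PStar.{u} r n))} (a : GrassSections k U) (D : U) :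
    invariants k D.1.parts :=
  a.1 D

variable {r n} in
/-- The sections on an open subset of the universal bundle: the compatible families of equivariant
vectors. -/
def bundleSections (U : Opens (TopCat.of (PStar.{u} r n))) :
    AddSubgroup (∀ D : U, equivariantVectors k D.1.parts) where
  carrier := {s | (compatible (bundleFunctor k r n)).pred s}
  zero_mem' := fun x y h => map_zero (equivariantVectors.res k h)
  add_mem' {s t} hs ht x y h := by
    have hs' : equivariantVectors.res k h (s x) = s y := hs x y h
    have ht' : equivariantVectors.res k h (t x) = t y := ht x y h
    change equivariantVectors.res k h (s x + t x) = s y + t y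
    rw [map_add, hs', ht']
  neg_mem' {s} hs x y h := by
    have hs' : equivariantVectors.res k h (s x) = s y := hs x y h
    change equivariantVectors.res k h (-s x) = -s y
    rw [map_neg, hs']

variable {r n} in
instance (U : Opens (TopCat.of (PStar.{u} r n))) :
    SMul (GrassSections k U) (bundleSections k U) where
  smul a s := ⟨fun D => (GrassSections.value a D) • s.1 D, fun x y h => by
    have ha : invariants.res k h (GrassSections.value a x) = GrassSections.value a y := a.2 x y h
    have hs : equivariantVectors.res k h (s.1 x) = s.1 y := s.2 x y h
    change equivariantVectors.res k h ((GrassSections.value a x) • s.1 x) =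
      (GrassSections.value a y) • s.1 y
    rw [equivariantVectors.res_smul, ha, hs]⟩

variable {r n} in
instance bundleModule (U : Opens (TopCat.of (PStar.{u} r n))) :
    Module (GrassSections k U) (bundleSections k U) where
  one_smul s := Subtype.ext (funext fun D => one_smul (invariants k D.1.parts) (s.1 D))
  mul_smul a b s := Subtype.ext (funext fun D =>
    mul_smul (GrassSections.value a D) (GrassSections.value b D) (s.1 D))
  smul_zero a := Subtype.ext (funext fun D => smul_zero (GrassSections.value a D))
  smul_add a s t := Subtype.ext (funext fun D =>
    smul_add (GrassSections.value a D) (s.1 D) (t.1 D))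
  add_smul a b s := Subtype.ext (funext fun D =>
    add_smul (GrassSections.value a D) (GrassSections.value b D) (s.1 D))
  zero_smul s := Subtype.ext (funext fun D => zero_smul (invariants k D.1.parts) (s.1 D))

/-- The universal bundle as a presheaf of abelian groups. -/
def bundlePresheafAb : (Opens (TopCat.of (PStar.{u} r n)))ᵒᵖ ⥤ Ab.{u} where
  obj U := AddCommGrpCat.of (bundleSections k U.unop)
  map {U V} i := AddCommGrpCat.ofHom
    { toFun := fun s => ⟨fun x => s.1 ⟨x.1, i.unop.le x.2⟩,
        (compatible (bundleFunctor k r n)).res i.unop _ s.2⟩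
      map_zero' := rfl
      map_add' := fun _ _ => rfl }

theorem bundlePresheafAb_isSheaf :
    TopCat.Presheaf.IsSheaf (X := TopCat.of (PStar.{u} r n)) (bundlePresheafAb k r n) := by
  rw [TopCat.Presheaf.isSheaf_iff_isSheaf_comp (forget Ab.{u})]
  refine TopCat.Presheaf.isSheaf_of_iso (F := TopCat.subpresheafToTypes
      (compatible (bundleFunctor k r n)).toPrelocalPredicate)
    (NatIso.ofComponents (fun _ => Equiv.toIso (Equiv.refl _)) ?_)
    (TopCat.subpresheafToTypes.isSheaf (compatible (bundleFunctor k r n)))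
  intros
  rfl

/-- The universal bundle as a presheaf of modules. -/
def bundlePresheaf : PresheafOfModules.{u} (Grass k r n).ringSheaf.obj :=
  letI (U : (Opens (Grass k r n).space)ᵒᵖ) :
      Module ((Grass k r n).ringSheaf.obj.obj U)
        ((bundlePresheafAb k r n : (Opens (Grass k r n).space)ᵒᵖ ⥤ Ab.{u}).obj U) :=
    (bundleModule k U.unop : Module (GrassSections k U.unop) (bundleSections k U.unop))
  PresheafOfModules.ofPresheaf (R := (Grass k r n).ringSheaf.obj)
    (bundlePresheafAb k r n : (Opens (Grass k r n).space)ᵒᵖ ⥤ Ab.{u})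
    (fun _ _ _ _ _ => rfl)

/-- The universal bundle: the sheaf of sections of the quotient of `Epim × 𝔸^r` by `GL_r` over the
grassmannian. -/
def universalBundle : (Grass k r n).Modules where
  val := bundlePresheaf k r n
  isSheaf := bundlePresheafAb_isSheaf k r n

variable {n} in
/-- The `j`-th column of the generic matrix, as an equivariant vector. -/
def column (D : Set (RSubset r n)) (j : Fin n) : equivariantVectors k D :=
  ⟨fun i => algebraMap (HomRing k r n) (EpimRing k D) (MvPolynomial.X (i, j)), fun i => by
    rw [coact_algebraMap]
    simp [coactPoly]⟩

/-- The image of the `j`-th vector of the standard basis by the universal morphism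
`O^n ⟶ universalBundle`: the `j`-th column of the generic matrix. -/
def universalColumn (j : Fin n) : globalSections (universalBundle k r n) :=
  (⟨fun D => column k r D.1.parts j, fun _ _ h =>
    Subtype.ext (funext fun _ => EpimRing.res_algebraMap h _)⟩ : bundleSections k ⊤)

/-- The universal algebro-topological quotient: the universal bundle, the columns of the generic
matrix and the open subsets `{D | δ ∈ D}`. -/
def universalQuotient : QuotientDatum r n (Grass k r n) where
  E := universalBundle k r n
  φ := universalColumn k r n
  U := PStar.basicOpen

end Universal

end GrassRS

end

open GrassRS

/-! The idea is to replace a quotient by matrices. On `U_δ` the section `⋀^r φ_δ` trivializes `⋀^r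
E`, so, `E` being locally free of rank `r`, the sections of `φ` with index in `δ` form a basis of
`E` there (`comb_bijective_of_subset_wedgeLocus`). The coordinates of all `φ_j` in this basis form
an `r × n` matrix `A_δ` of functions on `U_δ`. Write `(A)_δ` for the columns with index in `δ`. Then
`(A_δ)_δ = 1`, and `A_δ = (A_δ)_δ' * A_δ'` on overlaps. This is the notion `IsFramed`. The couple
`(E, φ)` is determined by the covering and the matrices up to a unique isomorphism
(`IsFramed.exists_iso`), the matrices are determined by the class, and all matrices with these two
properties come from a sheaf obtained by gluing (`exists_isFramed`). The inverse image of a quotient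
is the quotient given by the inverse images of the matrices (`IsFramed.pullback`).

It remains to see that such families of matrices are the same as morphisms to the grassmannian. A
continuous map to `PStar` is the same as a covering indexed by the `r`-subsets: a point `x` goes to
`{δ | x ∈ U_δ}`. For the functions, let `δ ∈ D` and let `Y = (X)_δ⁻¹ * X` be the matrix of affine
coordinates, with `X` generic. Its entries are invariant, and an invariant takes the same value at
`X` and at `Y`, so that evaluation at `Y` is a retraction of the localized polynomial ring onto the
invariants (`eval_affineCoords`).

Uniqueness follows: a morphism is determined by the open sets `h⁻¹ U_δ` and the inverse images of
the entries of `Y` (`hom_grass_ext`). For existence, invariants are evaluated at `A_δ`. The result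
does not depend on `δ`, because `A_δ` and `A_δ'` differ by an invertible matrix on the left
(`IsFramed.localEval_eq`), so the local evaluations glue. Since `(A_δ)_δ = 1`, the matrix `Y` is
sent to `A_δ`. -/

noncomputable section

namespace GrassRS

/-! ### Sections, restrictions and gluing for functions and for sheaves of modules. -/

namespace RingedSpaceOver
variable {k : Type u} [CommRing k] {S T : RingedSpaceOver k}

/-- The ring of sections of the structure sheaf on an open subset. -/
def Fn (S : RingedSpaceOver k) (U : Opens S.space) : Type u := S.toRingedSpace.presheaf.obj (op U)

instance (U : Opens S.space) : CommRing (Fn S U) :=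
  inferInstanceAs (CommRing (S.toRingedSpace.presheaf.obj (op U)))

/-- The restriction of functions. -/
def Fn.res {U V : Opens S.space} (h : V ≤ U) : Fn S U →+* Fn S V :=
  (S.toRingedSpace.presheaf.map (homOfLE h).op).hom

/-- The module of sections of a sheaf of modules on an open subset. -/
def Sec (E : S.Modules) (U : Opens S.space) : Type u := E.val.obj (op U)

variable {E F : S.Modules} {U V W : Opens S.space}

instance : AddCommGroup (Sec E U) := inferInstanceAs (AddCommGroup (E.val.obj (op U)))

instance : Module (Fn S U) (Sec E U) :=
  inferInstanceAs (Module (S.toRingedSpace.presheaf.obj (op U)) (E.val.obj (op U)))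

/-- The restriction of sections. -/
def Sec.res (h : V ≤ U) : Sec E U →+ Sec E V :=
  (E.val.map (homOfLE h).op).hom.toAddMonoidHom

theorem Fn.res_res (h : V ≤ U) (h' : W ≤ V) (a : Fn S U) :
    Fn.res h' (Fn.res h a) = Fn.res (h'.trans h) a :=
  (ConcreteCategory.congr_hom
    (S.toRingedSpace.presheaf.map_comp (homOfLE h).op (homOfLE h').op) a).symm

theorem Fn.res_self (h : U ≤ U) (a : Fn S U) : Fn.res h a = a :=
  ConcreteCategory.congr_hom (S.toRingedSpace.presheaf.map_id (op U)) a

theorem Sec.res_res (h : V ≤ U) (h' : W ≤ V) (s : Sec E U) :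
    Sec.res h' (Sec.res h s) = Sec.res (h'.trans h) s :=
  (E.val.map_comp_apply (homOfLE h).op (homOfLE h').op s).symm

theorem Sec.res_self (h : U ≤ U) (s : Sec E U) : Sec.res h s = s :=
  ConcreteCategory.congr_hom (E.val.presheaf.map_id (op U)) s

theorem Sec.res_smul (h : V ≤ U) (a : Fn S U) (s : Sec E U) :
    Sec.res h (a • s) = Fn.res h a • Sec.res h s :=
  E.val.map_smul (homOfLE h).op a s

theorem Sec.res_sum_smul {ι : Type*} (t : Finset ι) (h : V ≤ U) (a : ι → Fn S U) (s : ι → Sec E U) :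
    Sec.res h (∑ i ∈ t, a i • s i) = ∑ i ∈ t, Fn.res h (a i) • Sec.res h (s i) := by
  simp only [map_sum, Sec.res_smul]

theorem Fn.eq_of_locally {a b : Fn S U}
    (h : ∀ x ∈ U, ∃ V, x ∈ V ∧ ∃ hV : V ≤ U, Fn.res hV a = Fn.res hV b) : a = b := by
  choose V hx hV h using h
  exact TopCat.Sheaf.eq_of_locally_eq' ⟨S.toRingedSpace.presheaf, S.toRingedSpace.IsSheaf⟩
    (fun x : U => V x.1 x.2) U (fun x => homOfLE (hV x.1 x.2))
    (fun x hxU => Opens.mem_iSup.mpr ⟨⟨x, hxU⟩, hx x hxU⟩) a b fun x => h x.1 x.2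

theorem Sec.eq_of_locally {s t : Sec E U}
    (h : ∀ x ∈ U, ∃ V, x ∈ V ∧ ∃ hV : V ≤ U, Sec.res hV s = Sec.res hV t) : s = t := by
  choose V hx hV h using h
  exact TopCat.Sheaf.eq_of_locally_eq' (X := S.space) ⟨E.val.presheaf, E.isSheaf⟩
    (fun x : U => V x.1 x.2) U (fun x => homOfLE (hV x.1 x.2))
    (fun x hxU => Opens.mem_iSup.mpr ⟨⟨x, hxU⟩, hx x hxU⟩) s t fun x => h x.1 x.2

theorem Fn.exists_glue {ι : Type*} (W : ι → Opens S.space) (hW : ∀ i, W i ≤ U)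
    (hc : ∀ x ∈ U, ∃ i, x ∈ W i) (a : ∀ i, Fn S (W i))
    (h : ∀ i j, Fn.res (inf_le_left : W i ⊓ W j ≤ W i) (a i) = Fn.res inf_le_right (a j)) :
    ∃ b : Fn S U, ∀ i, Fn.res (hW i) b = a i :=
  (TopCat.Sheaf.existsUnique_gluing' ⟨S.toRingedSpace.presheaf, S.toRingedSpace.IsSheaf⟩
    W U (fun i => homOfLE (hW i)) (fun x hx => Opens.mem_iSup.mpr (hc x hx)) a h).exists

theorem Sec.exists_glue {ι : Type*} (W : ι → Opens S.space) (hW : ∀ i, W i ≤ U)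
    (hc : ∀ x ∈ U, ∃ i, x ∈ W i) (s : ∀ i, Sec E (W i))
    (h : ∀ i j, Sec.res (inf_le_left : W i ⊓ W j ≤ W i) (s i) = Sec.res inf_le_right (s j)) :
    ∃ t : Sec E U, ∀ i, Sec.res (hW i) t = s i := by
  let s' : ∀ i, ToType ((⟨E.val.presheaf, E.isSheaf⟩ : TopCat.Sheaf Ab.{u} S.space).1.obj
    (op (W i))) := s
  exact (TopCat.Sheaf.existsUnique_gluing' (X := S.space) ⟨E.val.presheaf, E.isSheaf⟩
    W U (fun i => homOfLE (hW i)) (fun x hx => Opens.mem_iSup.mpr (hc x hx)) s' h).exists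

/-- The map on sections given by a morphism of sheaves of modules. -/
def Sec.map (ψ : E ⟶ F) (U : Opens S.space) : Sec E U →ₗ[Fn S U] Sec F U where
  toFun := (ψ.val.app (op U)).hom
  map_add' := map_add (ψ.val.app (op U)).hom
  map_smul' := map_smul (ψ.val.app (op U)).hom

theorem Sec.map_res (ψ : E ⟶ F) (h : V ≤ U) (s : Sec E U) :
    Sec.map ψ V (Sec.res h s) = Sec.res h (Sec.map ψ U s) :=
  PresheafOfModules.naturality_apply ψ.val (homOfLE h).op s

/-- A family of linear maps compatible with the restrictions is a morphism of sheaves. -/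
def Sec.homMk (f : ∀ U : Opens S.space, Sec E U →ₗ[Fn S U] Sec F U)
    (hf : ∀ (U V : Opens S.space) (h : V ≤ U) (s : Sec E U),
      f V (Sec.res h s) = Sec.res h (f U s)) : E ⟶ F where
  val := PresheafOfModules.homMk
    { app := fun U => AddCommGrpCat.ofHom (f U.unop).toAddMonoidHom
      naturality := fun U V i => by
        ext s
        exact hf U.unop V.unop i.unop.le s }
    (fun U a s => (f U.unop).map_smul a s)

theorem Sec.map_homMk (f : ∀ U : Opens S.space, Sec E U →ₗ[Fn S U] Sec F U)
    (hf : ∀ (U V : Opens S.space) (h : V ≤ U) (s : Sec E U),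
      f V (Sec.res h s) = Sec.res h (f U s)) (U : Opens S.space) (s : Sec E U) :
    Sec.map (Sec.homMk f hf) U s = f U s := rfl

theorem Sec.hom_ext {ψ ψ' : E ⟶ F} (h : ∀ U s, Sec.map ψ U s = Sec.map ψ' U s) : ψ = ψ' := by
  refine SheafOfModules.hom_ext (PresheafOfModules.hom_ext fun U => ?_)
  ext s
  exact h U.unop s

end RingedSpaceOver

/-! ### Morphisms out of a sheaf of modules generated by global sections. -/

namespace RingedSpaceOver
variable {k : Type u} [CommRing k] {S T : RingedSpaceOver k}

section Generators
variable {E F : S.Modules} {ι : Type*} [Fintype ι]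

/-- The linear combination of the restrictions of global sections. -/
def Sec.comb (φ : ι → Sec E ⊤) {V : Opens S.space} (c : ι → Fn S V) : Sec E V :=
  ∑ j, c j • Sec.res le_top (φ j)

theorem Sec.res_comb (φ : ι → Sec E ⊤) {V W : Opens S.space} (h : W ≤ V) (c : ι → Fn S V) :
    Sec.res h (Sec.comb φ c) = Sec.comb φ (fun j => Fn.res h (c j)) := by
  simp only [Sec.comb, Sec.res_sum_smul, Sec.res_res]

theorem Sec.comb_add (φ : ι → Sec E ⊤) {V : Opens S.space} (c d : ι → Fn S V) :
    Sec.comb φ (c + d) = Sec.comb φ c + Sec.comb φ d := by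
  simp [Sec.comb, add_smul, Finset.sum_add_distrib]

theorem Sec.comb_sub (φ : ι → Sec E ⊤) {V : Opens S.space} (c d : ι → Fn S V) :
    Sec.comb φ (c - d) = Sec.comb φ c - Sec.comb φ d := by
  simp [Sec.comb, sub_smul, Finset.sum_sub_distrib]

theorem Sec.comb_smul (φ : ι → Sec E ⊤) {V : Opens S.space} (a : Fn S V) (c : ι → Fn S V) :
    Sec.comb φ (a • c) = a • Sec.comb φ c := by
  simp [Sec.comb, mul_smul, Finset.smul_sum]

theorem Sec.comb_single [DecidableEq ι] (φ : ι → Sec E ⊤) {V : Opens S.space} (j : ι) :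
    Sec.comb φ (Pi.single j 1 : ι → Fn S V) = Sec.res le_top (φ j) := by
  simp [Sec.comb, Pi.single_apply, ite_smul]

theorem Sec.map_comb (ψ : E ⟶ F) (φ : ι → Sec E ⊤) {V : Opens S.space} (c : ι → Fn S V) :
    Sec.map ψ V (Sec.comb φ c) = Sec.comb (fun j => Sec.map ψ ⊤ (φ j)) c := by
  simp [Sec.comb, Sec.map_res]

/-- Global sections generate a sheaf of modules if locally every section is a linear combination of
them. -/
def Generates (φ : ι → Sec E ⊤) : Prop :=
  ∀ (U : Opens S.space) (s : Sec E U), ∀ x ∈ U, ∃ V, x ∈ V ∧ ∃ (hV : V ≤ U) (c : ι → Fn S V),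
    Sec.res hV s = Sec.comb φ c

theorem Generates.hom_ext {φ : ι → Sec E ⊤} (hφ : Generates φ) {ψ ψ' : E ⟶ F}
    (h : ∀ j, Sec.map ψ ⊤ (φ j) = Sec.map ψ' ⊤ (φ j)) : ψ = ψ' := by
  refine Sec.hom_ext fun U s => Sec.eq_of_locally fun x hx => ?_
  obtain ⟨V, hxV, hV, c, hc⟩ := hφ U s x hx
  refine ⟨V, hxV, hV, ?_⟩
  rw [← Sec.map_res, ← Sec.map_res, hc, Sec.map_comb, Sec.map_comb]
  simp only [h]

/-- Where `s` is a combination of the `φ_j`, its image has to be the same combination of the `f_j`;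
by `hf` this does not depend on the coefficients, so these local candidates glue. The conclusion
covers every local expression of `s`, not only the chosen ones, and this reduces linearity and
compatibility with restrictions in `Generates.exists_hom` to local computations. -/
theorem Generates.exists_section {φ : ι → Sec E ⊤} (hφ : Generates φ) {f : ι → Sec F ⊤}
    (hf : ∀ (V : Opens S.space) (c : ι → Fn S V), Sec.comb φ c = 0 → Sec.comb f c = 0)
    {U : Opens S.space} (s : Sec E U) :
    ∃ t : Sec F U, ∀ (V : Opens S.space) (hV : V ≤ U) (c : ι → Fn S V),
      Sec.res hV s = Sec.comb φ c → Sec.res hV t = Sec.comb f c := by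
  have hf' : ∀ (V : Opens S.space) (c d : ι → Fn S V), Sec.comb φ c = Sec.comb φ d →
      Sec.comb f c = Sec.comb f d := fun V c d h => by
    rw [← sub_eq_zero, ← Sec.comb_sub] at h ⊢
    exact hf V _ h
  choose V hx hV c hc using hφ U s
  obtain ⟨t, ht⟩ := Sec.exists_glue (E := F) (fun x : U => V x.1 x.2) (fun x => hV x.1 x.2)
    (fun x hxU => ⟨⟨x, hxU⟩, hx x hxU⟩) (fun x => Sec.comb f (c x.1 x.2)) (fun x y => by
      rw [Sec.res_comb, Sec.res_comb]
      apply hf'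
      rw [← Sec.res_comb, ← Sec.res_comb, ← hc, ← hc, Sec.res_res, Sec.res_res])
  refine ⟨t, fun W hW d hd => Sec.eq_of_locally fun x hxW => ?_⟩
  refine ⟨W ⊓ V x (hW hxW), ⟨hxW, hx _ _⟩, inf_le_left, ?_⟩
  have h1 := ht ⟨x, hW hxW⟩
  have h2 := congrArg (Sec.res (inf_le_right : W ⊓ V x (hW hxW) ≤ _)) h1
  rw [Sec.res_res] at h2
  rw [Sec.res_res, h2, Sec.res_comb, Sec.res_comb]
  apply hf'
  rw [← Sec.res_comb, ← Sec.res_comb, ← hc, ← hd, Sec.res_res, Sec.res_res]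

/-- A morphism from a sheaf of modules can be defined on generators if the relations are
satisfied. -/
theorem Generates.exists_hom {φ : ι → Sec E ⊤} (hφ : Generates φ) {f : ι → Sec F ⊤}
    (hf : ∀ (V : Opens S.space) (c : ι → Fn S V), Sec.comb φ c = 0 → Sec.comb f c = 0) :
    ∃ ψ : E ⟶ F, ∀ j, Sec.map ψ ⊤ (φ j) = f j := by
  classical
  choose t ht using fun (U : Opens S.space) (s : Sec E U) => hφ.exists_section hf s
  refine ⟨Sec.homMk
    (fun U => { toFun := t U, map_add' := fun s s' => ?_, map_smul' := fun a s => ?_ })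
    fun U V h s => ?_, fun j => ?_⟩
  · refine Sec.eq_of_locally fun x hx => ?_
    obtain ⟨V, hxV, hV, c, hc⟩ := hφ U s x hx
    obtain ⟨V', hxV', hV', c', hc'⟩ := hφ U s' x hx
    have h1 := congrArg (Sec.res (inf_le_left : V ⊓ V' ≤ V)) hc
    have h2 := congrArg (Sec.res (inf_le_right : V ⊓ V' ≤ V')) hc'
    rw [Sec.res_comb, Sec.res_res] at h1 h2
    refine ⟨V ⊓ V', ⟨hxV, hxV'⟩, inf_le_left.trans hV, ?_⟩
    rw [map_add, ht U s _ _ _ h1, ht U s' _ _ _ h2, ← Sec.comb_add]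
    refine ht U _ _ _ _ ?_
    rw [map_add, h1, h2, ← Sec.comb_add]
  · refine Sec.eq_of_locally fun x hx => ?_
    obtain ⟨V, hxV, hV, c, hc⟩ := hφ U s x hx
    refine ⟨V, hxV, hV, ?_⟩
    rw [RingHom.id_apply, Sec.res_smul, ht U s _ _ _ hc, ← Sec.comb_smul]
    refine ht U _ _ _ _ ?_
    rw [Sec.res_smul, hc, ← Sec.comb_smul]
  · refine Sec.eq_of_locally fun x hx => ?_
    obtain ⟨W, hxW, hW, c, hc⟩ := hφ V (Sec.res h s) x hx
    refine ⟨W, hxW, hW, ?_⟩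
    change Sec.res hW (t V (Sec.res h s)) = Sec.res hW (Sec.res h (t U s))
    rw [ht V _ _ _ _ hc, Sec.res_res]
    refine (ht U s _ _ _ ?_).symm
    rw [← hc, Sec.res_res]
  · rw [Sec.map_homMk]
    have := ht ⊤ (φ j) ⊤ le_rfl (Pi.single j 1) (by rw [Sec.comb_single])
    rwa [Sec.comb_single, Sec.res_self, Sec.res_self] at this

end Generators

/-! ### Framings: a covering with a basis and a coordinate matrix on each open subset. -/

section Framed
variable {r n : ℕ} {E F : S.Modules}

/-- The sections of `φ` with indices in `δ` form a basis of `E` on `U_δ`, in which the coordinates of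
the sections of `φ` are the columns of the matrix `A_δ`. -/
structure IsFramed (E : S.Modules) (φ : Fin n → Sec E ⊤) (U : RSubset r n → Opens S.space)
    (A : ∀ δ, Matrix (Fin r) (Fin n) (Fn S (U δ))) : Prop where
  covers : ∀ x : S.space, ∃ δ, x ∈ U δ
  basis : ∀ δ, ∀ V ≤ U δ, Function.Bijective
    (fun a : Fin r → Fn S V => Sec.comb (fun i => φ (δ.emb i)) a)
  coord : ∀ δ j, Sec.res le_top (φ j) = Sec.comb (fun i => φ (δ.emb i)) (fun i => A δ i j)

variable {φ : Fin n → Sec E ⊤} {U : RSubset r n → Opens S.space}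
  {A : ∀ δ, Matrix (Fin r) (Fin n) (Fn S (U δ))}

/-- The sections `f` need not contain bases: only the relations encoded by `A` are assumed. It is
applied both to a framed sheaf and to the target of a morphism still to be constructed. -/
theorem comb_eq_of_coord {f : Fin n → Sec F ⊤}
    (hf : ∀ δ j, Sec.res le_top (f j) = Sec.comb (fun i => f (δ.emb i)) (fun i => A δ i j))
    {δ : RSubset r n} {V : Opens S.space} (hV : V ≤ U δ) (c : Fin n → Fn S V) :
    Sec.comb f c = Sec.comb (fun i => f (δ.emb i)) (fun i => ∑ j, c j * Fn.res hV (A δ i j)) := by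
  have h : ∀ j, (Sec.res le_top (f j) : Sec F V) =
      Sec.comb (fun i => f (δ.emb i)) (fun i => Fn.res hV (A δ i j)) := fun j => by
    rw [← Sec.res_comb, ← hf, Sec.res_res]
  calc Sec.comb f c = ∑ j, c j • ∑ i, Fn.res hV (A δ i j) • Sec.res le_top (f (δ.emb i)) :=
        Finset.sum_congr rfl fun j _ => by rw [h j]; rfl
    _ = _ := by
      simp only [Sec.comb, Finset.smul_sum, Finset.sum_smul, mul_smul]
      exact Finset.sum_comm

theorem IsFramed.generates (hE : IsFramed E φ U A) : Generates φ := by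
  classical
  intro V s x hx
  obtain ⟨δ, hδ⟩ := hE.covers x
  obtain ⟨a, ha⟩ := (hE.basis δ (V ⊓ U δ) inf_le_right).2 (Sec.res inf_le_left s)
  -- The coefficients `a` on `δ`, extended by zero to all `n` indices.
  refine ⟨V ⊓ U δ, ⟨hx, hδ⟩, inf_le_left, ∑ i, Pi.single (δ.emb i) (a i), ?_⟩
  rw [← ha]
  simp only [Sec.comb, Finset.sum_apply, Finset.sum_smul]
  rw [Finset.sum_comm]
  refine Finset.sum_congr rfl fun i _ => ?_
  simp [Pi.single_apply, ite_smul]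

/-- On `V ⊓ U_δ` a relation between the `φ_j` turns into a relation between the basis sections, with
coefficients computed from `A_δ`; these coefficients vanish. The same coefficients appear when the
`f_j` are expressed through those with index in `δ`, so the relation holds for `f` too. -/
theorem IsFramed.exists_hom (hE : IsFramed E φ U A) {f : Fin n → Sec F ⊤}
    (hf : ∀ δ j, Sec.res le_top (f j) = Sec.comb (fun i => f (δ.emb i)) (fun i => A δ i j)) :
    ∃ ψ : E ⟶ F, ∀ j, Sec.map ψ ⊤ (φ j) = f j := by
  refine hE.generates.exists_hom fun V c hc => Sec.eq_of_locally fun x hx => ?_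
  obtain ⟨δ, hδ⟩ := hE.covers x
  refine ⟨V ⊓ U δ, ⟨hx, hδ⟩, inf_le_left, ?_⟩
  have h1 := congrArg (Sec.res (inf_le_left : V ⊓ U δ ≤ V)) hc
  rw [Sec.res_comb, comb_eq_of_coord hE.coord inf_le_right, map_zero] at h1
  have h2 : (0 : Sec E (V ⊓ U δ)) = Sec.comb (fun i => φ (δ.emb i)) 0 := by simp [Sec.comb]
  rw [h2] at h1
  have h3 := (hE.basis δ (V ⊓ U δ) inf_le_right).1 h1
  rw [Sec.res_comb, comb_eq_of_coord hf inf_le_right, h3, map_zero]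
  simp [Sec.comb]

/-- Sheaves of modules with the same framing are isomorphic. -/
theorem IsFramed.exists_iso {φ' : Fin n → Sec F ⊤} (hE : IsFramed E φ U A)
    (hF : IsFramed F φ' U A) : ∃ ψ : E ≅ F, ∀ j, Sec.map ψ.hom ⊤ (φ j) = φ' j := by
  obtain ⟨ψ, hψ⟩ := hE.exists_hom hF.coord
  obtain ⟨ψ', hψ'⟩ := hF.exists_hom hE.coord
  refine ⟨⟨ψ, ψ', hE.generates.hom_ext fun j => ?_, hF.generates.hom_ext fun j => ?_⟩, hψ⟩
  · change Sec.map ψ' ⊤ (Sec.map ψ ⊤ (φ j)) = φ j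
    rw [hψ, hψ']
  · change Sec.map ψ ⊤ (Sec.map ψ' ⊤ (φ' j)) = φ' j
    rw [hψ', hψ]

theorem Sec.map_bijective (ψ : E ≅ F) (V : Opens S.space) :
    Function.Bijective (Sec.map ψ.hom V) :=
  Function.bijective_iff_has_inverse.mpr ⟨Sec.map ψ.inv V,
    fun s => congrArg (fun f : E ⟶ E => Sec.map f V s) ψ.hom_inv_id,
    fun s => congrArg (fun f : F ⟶ F => Sec.map f V s) ψ.inv_hom_id⟩

theorem IsFramed.of_iso {φ' : Fin n → Sec F ⊤} (hE : IsFramed E φ U A) (ψ : E ≅ F)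
    (h : ∀ j, Sec.map ψ.hom ⊤ (φ j) = φ' j) : IsFramed F φ' U A where
  covers := hE.covers
  basis δ V hV := by
    convert (Sec.map_bijective ψ V).comp (hE.basis δ V hV) using 1
    funext a
    simp only [Function.comp_apply, Sec.map_comb, h]
  coord δ j := by
    have := congrArg (Sec.map ψ.hom (U δ)) (hE.coord δ j)
    rw [Sec.map_comb, Sec.map_res] at this
    simpa only [h] using this

/-- The matrices of a framing are unique. -/
theorem IsFramed.matrix_unique {B : ∀ δ, Matrix (Fin r) (Fin n) (Fn S (U δ))}
    (hA : IsFramed E φ U A) (hB : IsFramed E φ U B) : A = B := by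
  funext δ
  ext i j
  exact congrFun ((hA.basis δ (U δ) le_rfl).1 ((hA.coord δ j).symm.trans (hB.coord δ j))) i

/-- The relations between the matrices of a framing. -/
theorem IsFramed.cocycle (hE : IsFramed E φ U A) (δ δ' : RSubset r n) {V : Opens S.space}
    (h : V ≤ U δ) (h' : V ≤ U δ') :
    (A δ).map (Fn.res h) =
      ((A δ).map (Fn.res h)).submatrix id δ'.emb * (A δ').map (Fn.res h') := by
  ext i j
  refine congrFun (f := fun i => (A δ).map (Fn.res h) i j)
    (g := fun i => (((A δ).map (Fn.res h)).submatrix id δ'.emb * (A δ').map (Fn.res h')) i j)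
    ((hE.basis δ V h).1 ?_) i
  have h1 := congrArg (Sec.res h) (hE.coord δ j)
  have h2 := congrArg (Sec.res h') (hE.coord δ' j)
  rw [Sec.res_comb, Sec.res_res] at h1 h2
  change Sec.comb _ (fun i => Fn.res h (A δ i j)) = _
  rw [← h1, h2]
  -- The columns of `A_δ` with index in `δ'` form the change of basis matrix from the basis of `δ'`
  -- to that of `δ`.
  have h3 : ∀ l, (Sec.res le_top (φ (δ'.emb l)) : Sec E V) =
      Sec.comb (fun i => φ (δ.emb i)) (fun i => Fn.res h (A δ i (δ'.emb l))) := fun l => by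
    rw [← Sec.res_comb, ← hE.coord, Sec.res_res]
  simp only [Sec.comb, Matrix.mul_apply, Finset.sum_smul, Matrix.submatrix_apply, Matrix.map_apply,
    id_eq, mul_comm (Fn.res h _), mul_smul]
  rw [Finset.sum_comm]
  refine Finset.sum_congr rfl fun l _ => ?_
  rw [h3 l]
  simp only [Sec.comb, Finset.smul_sum]

theorem IsFramed.submatrix_self (hE : IsFramed E φ U A) (δ : RSubset r n) :
    (A δ).submatrix id δ.emb = 1 := by
  ext i j
  refine congrFun (f := fun i => (A δ).submatrix id δ.emb i j)
    (g := fun i => (1 : Matrix _ _ (Fn S (U δ))) i j) ((hE.basis δ (U δ) le_rfl).1 ?_) i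
  refine (hE.coord δ (δ.emb j)).symm.trans ?_
  simp [Sec.comb, Matrix.one_apply, ite_smul]

end Framed

end RingedSpaceOver

/-! ### Gluing of free modules along transition matrices. -/

namespace RingedSpaceOver
variable {k : Type u} [CommRing k] {S T : RingedSpaceOver k}

section Gluing
variable {r n : ℕ} {U : RSubset r n → Opens S.space}

/-- The vectors of length `r` of functions on `V ⊓ U_δ`, as a module over the functions on `V`. -/
def LocalVectors (U : RSubset r n → Opens S.space) (V : Opens S.space) (δ : RSubset r n) : Type u :=
  Fin r → Fn S (V ⊓ U δ)

namespace LocalVectors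
variable {V W : Opens S.space}

instance (δ : RSubset r n) : AddCommGroup (LocalVectors U V δ) :=
  inferInstanceAs (AddCommGroup (Fin r → Fn S (V ⊓ U δ)))

instance (δ : RSubset r n) : Module (Fn S V) (LocalVectors U V δ) :=
  Module.compHom (Fin r → Fn S (V ⊓ U δ)) (Fn.res (inf_le_left : V ⊓ U δ ≤ V))

/-- The restriction of the entries of a vector. -/
def val {δ : RSubset r n} (v : LocalVectors U V δ) (h : W ≤ V) (h' : W ≤ U δ) : Fin r → Fn S W :=
  fun i => Fn.res (le_inf h h') (v i)

theorem val_add {δ : RSubset r n} (v w : LocalVectors U V δ) (h : W ≤ V) (h' : W ≤ U δ) :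
    (v + w).val h h' = v.val h h' + w.val h h' :=
  funext fun i => map_add (Fn.res (le_inf h h')) (v i) (w i)

theorem val_zero {δ : RSubset r n} (h : W ≤ V) (h' : W ≤ U δ) :
    (0 : LocalVectors U V δ).val h h' = 0 :=
  funext fun _ => map_zero (Fn.res (le_inf h h'))

theorem val_smul {δ : RSubset r n} (a : Fn S V) (v : LocalVectors U V δ) (h : W ≤ V)
    (h' : W ≤ U δ) : (a • v).val h h' = Fn.res h a • v.val h h' :=
  funext fun i => by
    change Fn.res (le_inf h h') (Fn.res inf_le_left a * v i) = _
    rw [map_mul, Fn.res_res]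
    rfl

theorem ext_val {δ : RSubset r n} {v w : LocalVectors U V δ}
    (h : v.val inf_le_left inf_le_right = w.val inf_le_left inf_le_right) : v = w :=
  funext fun i => by
    have := congrFun h i
    simpa only [val, Fn.res_self] using this

/-- The restriction of vectors of functions. -/
def res {δ : RSubset r n} (h : W ≤ V) : LocalVectors U V δ →+ LocalVectors U W δ where
  toFun v := v.val (inf_le_left.trans h) inf_le_right
  map_zero' := val_zero _ _
  map_add' v w := val_add v w _ _

theorem val_res {δ : RSubset r n} (h : W ≤ V) (v : LocalVectors U V δ) {W' : Opens S.space}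
    (h₁ : W' ≤ W) (h₂ : W' ≤ U δ) : (res h v).val h₁ h₂ = v.val (h₁.trans h) h₂ :=
  funext fun _ => Fn.res_res _ _ _

theorem res_val {δ : RSubset r n} {v : LocalVectors U V δ} {W' : Opens S.space}
    (h₁ : W ≤ V) (h₂ : W ≤ U δ) (h : W' ≤ W) (i : Fin r) :
    Fn.res h (v.val h₁ h₂ i) = v.val (h.trans h₁) (h.trans h₂) i :=
  Fn.res_res _ _ _

end LocalVectors

/-- The families of vectors of functions on the `V ⊓ U_δ` that are compatible with the change of
basis given by the matrices `A_δ`. -/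
def gluedVectors (A : ∀ δ, Matrix (Fin r) (Fin n) (Fn S (U δ))) (V : Opens S.space) :
    Submodule (Fn S V) (∀ δ, LocalVectors U V δ) where
  -- Asking for the relation on every `W` inside `V`, `U_δ` and `U_δ'` is equivalent to asking for
  -- it on the intersection, and makes stability under restriction immediate.
  carrier := {v | ∀ (δ δ' : RSubset r n) (W : Opens S.space) (hV : W ≤ V) (h : W ≤ U δ)
    (h' : W ≤ U δ'), (v δ).val hV h =
      (((A δ).map (Fn.res h)).submatrix id δ'.emb).mulVec ((v δ').val hV h')}
  zero_mem' δ δ' W hV h h' := by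
    simp only [Pi.zero_apply, LocalVectors.val_zero, Matrix.mulVec_zero]
  add_mem' {v w} hv hw δ δ' W hV h h' := by
    simp only [Pi.add_apply, LocalVectors.val_add, Matrix.mulVec_add, ← hv δ δ' W hV h h',
      ← hw δ δ' W hV h h']
  smul_mem' a v hv δ δ' W hV h h' := by
    simp only [Pi.smul_apply, LocalVectors.val_smul, Matrix.mulVec_smul, ← hv δ δ' W hV h h']

variable (A : ∀ δ, Matrix (Fin r) (Fin n) (Fn S (U δ)))

/-- The restriction of compatible families. -/
def gluedVectors.res {V W : Opens S.space} (h : W ≤ V) : gluedVectors A V →+ gluedVectors A W where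
  toFun v := ⟨fun δ => LocalVectors.res h (v.1 δ), fun δ δ' W' hV h₁ h₂ => by
    simp only [LocalVectors.val_res]
    exact v.2 δ δ' W' _ h₁ h₂⟩
  map_zero' := Subtype.ext (funext fun _ => map_zero (LocalVectors.res h))
  map_add' v w := Subtype.ext (funext fun δ => map_add (LocalVectors.res h) (v.1 δ) (w.1 δ))

theorem gluedVectors.res_self {V : Opens S.space} (h : V ≤ V) (v : gluedVectors A V) :
    gluedVectors.res A h v = v :=
  Subtype.ext (funext fun δ => funext fun i => Fn.res_self _ (v.1 δ i))

theorem gluedVectors.res_res {V W W' : Opens S.space} (h : W ≤ V) (h' : W' ≤ W)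
    (v : gluedVectors A V) :
    gluedVectors.res A h' (gluedVectors.res A h v) = gluedVectors.res A (h'.trans h) v :=
  Subtype.ext (funext fun δ => 
    LocalVectors.val_res h (v.1 δ) (inf_le_left.trans h') inf_le_right)

theorem gluedVectors.res_smul {V W : Opens S.space} (h : W ≤ V) (a : Fn S V)
    (v : gluedVectors A V) :
    gluedVectors.res A h (a • v) = Fn.res h a • gluedVectors.res A h v := by
  refine Subtype.ext (funext fun δ => 
    (LocalVectors.val_smul a (v.1 δ) (inf_le_left.trans h) inf_le_right).trans ?_)
  funext i
  change _ = Fn.res inf_le_left (Fn.res h a) * _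
  rw [Fn.res_res]
  rfl

/-- The compatible families as a presheaf of abelian groups. -/
def gluedPresheafAb : (Opens S.space)ᵒᵖ ⥤ Ab.{u} where
  obj V := AddCommGrpCat.of (gluedVectors A V.unop)
  map i := AddCommGrpCat.ofHom (gluedVectors.res A i.unop.le)
  map_id V := by
    ext v
    exact congrFun (congrArg Subtype.val (gluedVectors.res_self A le_rfl v)) _
  map_comp i j := by
    ext v
    exact congrFun (congrArg Subtype.val (gluedVectors.res_res A i.unop.le j.unop.le v).symm) _

/-- The entries of the vectors are functions and glue one by one; the change of basis relation for
the glued vectors is an equality of functions, hence can be checked on the covering. -/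
theorem gluedPresheafAb_isSheaf :
    TopCat.Presheaf.IsSheaf (X := S.space) (gluedPresheafAb A) := by
  refine (TopCat.Presheaf.isSheaf_iff_isSheafUniqueGluing (X := S.space) (gluedPresheafAb A)).mpr ?_
  intro ι W s hs
  change ∀ i, gluedVectors A (W i) at s
  change ∀ i j, gluedVectors.res A (inf_le_left : W i ⊓ W j ≤ W i) (s i) =
    gluedVectors.res A (inf_le_right : W i ⊓ W j ≤ W j) (s j) at hs
  change ∃! t : gluedVectors A (iSup W), ∀ i, gluedVectors.res A (le_iSup W i) t = s i
  have hs' : ∀ i j (V : Opens S.space) (hi : V ≤ W i) (hj : V ≤ W j) δ (h : V ≤ U δ),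
      ((s i).1 δ).val hi h = ((s j).1 δ).val hj h := by
    intro i j V hi hj δ h
    have := congrArg (fun t => (t.1 δ).val (le_inf hi hj) h) (hs i j)
    exact ((LocalVectors.val_res _ _ _ _).symm.trans this).trans (LocalVectors.val_res _ _ _ _)
  have ht : ∀ δ, ∃ t : LocalVectors U (iSup W) δ, ∀ i,
      t.val (inf_le_left.trans (le_iSup W i)) (inf_le_right : W i ⊓ U δ ≤ U δ) = (s i).1 δ := by
    intro δ
    have : ∀ l, ∃ b : Fn S (iSup W ⊓ U δ), ∀ i,
        Fn.res (inf_le_inf_right (U δ) (le_iSup W i)) b = (s i).1 δ l := fun l =>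
      Fn.exists_glue (fun i => W i ⊓ U δ) _
        (fun x (hx : x ∈ iSup W ⊓ U δ) => (Opens.mem_iSup.mp hx.1).imp fun i hi => ⟨hi, hx.2⟩)
        (fun i => (s i).1 δ l) fun i j =>
          congrFun (hs' i j _ (inf_le_left.trans inf_le_left) (inf_le_right.trans inf_le_left) δ
            (inf_le_left.trans inf_le_right)) l
    choose b hb using this
    exact ⟨b, fun i => funext fun l => hb l i⟩
  choose t ht using ht
  have ht' : ∀ δ i (V : Opens S.space) (h : V ≤ W i) (h' : V ≤ U δ),
      (t δ).val (h.trans (le_iSup W i)) h' = ((s i).1 δ).val h h' := by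
    intro δ i V h h'
    rw [← ht δ i]
    exact funext fun l => (Fn.res_res _ _ _).symm
  refine ⟨⟨t, ?_⟩, fun i => ?_, fun t' h => ?_⟩
  · intro δ δ' V hV h h'
    funext l
    refine Fn.eq_of_locally fun x hx => ?_
    obtain ⟨i, hi⟩ := Opens.mem_iSup.mp (hV hx)
    refine ⟨V ⊓ W i, ⟨hx, hi⟩, inf_le_left, ?_⟩
    simp only [Matrix.mulVec, dotProduct, map_sum, map_mul, LocalVectors.res_val,
      Matrix.submatrix_apply, Matrix.map_apply, Fn.res_res]
    rw [ht' δ i _ inf_le_right, ht' δ' i _ inf_le_right]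
    exact congrFun ((s i).2 δ δ' (V ⊓ W i) inf_le_right (inf_le_left.trans h)
      (inf_le_left.trans h')) l
  · exact Subtype.ext (funext fun δ => ht δ i)
  · refine Subtype.ext (funext fun δ => funext fun l => Fn.eq_of_locally fun x hx => ?_)
    obtain ⟨i, hi⟩ := Opens.mem_iSup.mp hx.1
    refine ⟨W i ⊓ U δ, ⟨hi, hx.2⟩, inf_le_inf_right _ (le_iSup W i), ?_⟩
    have h1 := congrFun (congrArg (fun v => v.1 δ) (h i)) l
    have h2 := congrFun (ht δ i) l
    exact h1.trans h2.symm

/-- The sheaf of modules obtained by gluing free modules. -/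
def gluedSheaf : S.Modules where
  val :=
    letI (V : (Opens S.space)ᵒᵖ) : Module (S.ringSheaf.obj.obj V) ((gluedPresheafAb A).obj V) :=
      inferInstanceAs (Module (Fn S V.unop) (gluedVectors A V.unop))
    PresheafOfModules.ofPresheaf (R := S.ringSheaf.obj) (gluedPresheafAb A)
      (fun _ _ i a v => gluedVectors.res_smul A i.unop.le a v)
  isSheaf := gluedPresheafAb_isSheaf A

variable {A}

theorem sec_gluedSheaf_comb {m : ℕ} (φ : Fin m → gluedVectors A ⊤) {V : Opens S.space}
    (c : Fin m → Fn S V) :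
    (Sec.comb (E := gluedSheaf A) φ c : gluedVectors A V) =
      ∑ j, c j • gluedVectors.res A le_top (φ j) := rfl

/-- Matrices that satisfy the relations of a change of basis are the matrices of a framing. -/
theorem exists_isFramed (hU : ∀ x : S.space, ∃ δ, x ∈ U δ)
    (h1 : ∀ δ, (A δ).submatrix id δ.emb = 1)
    (hA : ∀ (δ δ' : RSubset r n) (V : Opens S.space) (h : V ≤ U δ) (h' : V ≤ U δ'),
      (A δ).map (Fn.res h) =
        ((A δ).map (Fn.res h)).submatrix id δ'.emb * (A δ').map (Fn.res h')) :
    ∃ (E : S.Modules) (φ : Fin n → Sec E ⊤), IsFramed E φ U A := by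
  -- The section `φ_j` is the family of the `j`-th columns of the matrices; column `j` of `hA` says
  -- that this family is compatible.
  let φ : Fin n → gluedVectors A ⊤ := fun j =>
    ⟨fun δ i => Fn.res inf_le_right (A δ i j), fun δ δ' W hV h h' => by
      funext i
      have := congrFun (congrFun (hA δ δ' W h h') i) j
      rw [Matrix.mul_apply] at this
      refine (Fn.res_res _ _ _).trans (this.trans (Finset.sum_congr rfl fun l _ => ?_))
      exact congrArg _ (Fn.res_res _ _ _).symm⟩
  -- The `δ`-component of a combination of the `φ_(f i)` is the product of the columns `f i` of
  -- `A_δ` with the vector of coefficients. For `f = δ.emb` the matrix is the identity, so the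
  -- component is the vector of coefficients itself.
  have hval : ∀ {V : Opens S.space} {m : ℕ} (f : Fin m → Fin n) (c : Fin m → Fn S V)
      (δ : RSubset r n) (W : Opens S.space) (h : W ≤ V) (h' : W ≤ U δ),
      ((Sec.comb (E := gluedSheaf A) (fun i => φ (f i)) c : gluedVectors A V).1 δ).val h h' =
        (((A δ).map (Fn.res h')).submatrix id f).mulVec (fun i => Fn.res h (c i)) := by
    intro V m f c δ W h h'
    rw [sec_gluedSheaf_comb]
    have : ∀ s : Finset (Fin m), ((∑ j ∈ s, c j • gluedVectors.res A le_top (φ (f j)) :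
        gluedVectors A V).1 δ).val h h' =
        ∑ j ∈ s, (Fn.res h (c j)) • fun i => Fn.res h' (A δ i (f j)) := by
      intro s
      classical
      induction s using Finset.induction_on with
      | empty => exact LocalVectors.val_zero h h'
      | insert a s ha ih =>
        rw [Finset.sum_insert ha, Finset.sum_insert ha, ← ih]
        refine (LocalVectors.val_add _ _ _ _).trans (congrArg₂ (· + ·) ?_ rfl)
        refine (LocalVectors.val_smul _ _ _ _).trans (congrArg (fun v => Fn.res h (c a) • v) ?_)
        refine (LocalVectors.val_res _ _ _ _).trans (funext fun i => ?_)
        exact Fn.res_res _ _ _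
    rw [this]
    funext i
    simp [Matrix.mulVec, dotProduct, mul_comm]
  refine ⟨gluedSheaf A, φ, hU, fun δ V hV => ⟨fun a b hab => ?_, fun v => ?_⟩, fun δ j => ?_⟩
  · have h := congrArg (fun v : gluedVectors A V => (v.1 δ).val le_rfl hV) hab
    simp only [hval] at h
    have h2 : ((A δ).map (Fn.res hV)).submatrix id δ.emb = 1 := by
      rw [Matrix.submatrix_map, h1 δ, Matrix.map_one _ (map_zero _) (map_one _)]
    rw [h2, Matrix.one_mulVec, Matrix.one_mulVec] at h
    funext i
    simpa only [Fn.res_self] using congrFun h i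
  · change gluedVectors A V at v
    -- Over `V ≤ U_δ` the coordinates of `v` are its own `δ`-component; the gluing relation recovers
    -- all the other components from it.
    refine ⟨(v.1 δ).val le_rfl hV, Subtype.ext (funext fun δ' => LocalVectors.ext_val ?_)⟩
    refine (hval _ _ _ _ _ _).trans ?_
    refine Eq.trans ?_ (v.2 δ' δ _ inf_le_left inf_le_right (inf_le_left.trans hV)).symm
    simp only [LocalVectors.res_val]
  · refine Subtype.ext (funext fun δ' => LocalVectors.ext_val ?_)
    refine Eq.trans ?_ (hval _ _ _ _ _ _).symm
    refine (LocalVectors.val_res _ _ _ _).trans ?_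
    funext i
    have := congrFun (congrFun (hA δ' δ _ inf_le_right inf_le_left) i) j
    refine (Fn.res_res _ _ _).trans ?_
    exact this

end Gluing

end RingedSpaceOver

/-! ### Inverse images of framed sheaves. -/

namespace RingedSpaceOver
variable {k : Type u} [CommRing k] {S T : RingedSpaceOver k}

section Pullback

/-- The inverse image of an open subset. -/
abbrev preim (h : S ⟶ T) (V : Opens T.space) : Opens S.space := (Opens.map (base h)).obj V

/-- The inverse image of functions. -/
def Fn.comap (h : S ⟶ T) (V : Opens T.space) : Fn T V →+* Fn S (preim h V) :=
  ((Hom.hom h).hom.c.app (op V)).hom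

theorem Fn.comap_res (h : S ⟶ T) {V W : Opens T.space} (hW : W ≤ V) (a : Fn T V) :
    Fn.comap h W (Fn.res hW a) =
      Fn.res ((Opens.map (base h)).monotone hW) (Fn.comap h V a) :=
  ConcreteCategory.congr_hom ((Hom.hom h).hom.c.naturality (homOfLE hW).op) a

theorem Fn.res_comap_res (h : S ⟶ T) {V W : Opens T.space} (hW : W ≤ V) {W' : Opens S.space}
    (h' : W' ≤ preim h W) (h'' : W' ≤ preim h V) (a : Fn T V) :
    Fn.res h' (Fn.comap h W (Fn.res hW a)) = Fn.res h'' (Fn.comap h V a) := by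
  rw [Fn.comap_res, Fn.res_res]

variable {r n : ℕ} {E : T.Modules} {F : S.Modules}

/-- The inverse image is only known as a left adjoint. This lets morphisms out of `h^* E` be
computed on the sections `h^* s` by passing to morphisms out of `E`. -/
theorem sec_map_homEquiv (h : S ⟶ T) (g : (pullback h).obj E ⟶ F) (s : Sec E ⊤) :
    (Sec.map ((pullbackPushforwardAdj h).homEquiv E F g) ⊤ s : Sec F ⊤) =
      Sec.map g ⊤ (pullbackSection h s) := by
  rw [Adjunction.homEquiv_unit]
  rfl

variable {φ : Fin n → Sec E ⊤} {U : RSubset r n → Opens T.space}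
  {A : ∀ δ, Matrix (Fin r) (Fin n) (Fn T (U δ))}

/-- A framing of a sheaf of modules defines a framing of the inverse image. -/
theorem IsFramed.pullback (h : S ⟶ T) (hE : IsFramed E φ U A) :
    IsFramed ((pullback h).obj E) (fun j => pullbackSection h (φ j)) (fun δ => preim h (U δ))
      (fun δ => (A δ).map (Fn.comap h (U δ))) := by
  have hcoord : ∀ δ j, (Sec.res le_top (pullbackSection h (φ j)) :
      Sec ((RingedSpaceOver.pullback h).obj E) (preim h (U δ))) =
      Sec.comb (fun i => pullbackSection h (φ (δ.emb i)))
        (fun i => (A δ).map (Fn.comap h (U δ)) i j) := by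
    intro δ j
    -- The unit `E ⟶ h_* h^* E` is linear, so it carries the coordinate relations of `φ` to those of
    -- `h^* φ`.
    have h1 := congrArg (Sec.map ((pullbackPushforwardAdj h).unit.app E) (U δ)) (hE.coord δ j)
    rw [Sec.map_res, Sec.map_comb] at h1
    exact h1
  -- A model `E'` is glued from the inverse images of the matrices; it will be shown to be
  -- isomorphic to `h^* E`.
  obtain ⟨E', φ', hE'⟩ := exists_isFramed (U := fun δ => preim h (U δ))
    (A := fun δ => (A δ).map (Fn.comap h (U δ))) (fun x => hE.covers (base h x))
    (fun δ => by
      rw [Matrix.submatrix_map, hE.submatrix_self, Matrix.map_one _ (map_zero _) (map_one _)])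
    (fun δ δ' V hV hV' => by
      -- The cocycle relation on `T` is transported to `V` by this single ring homomorphism, defined
      -- on the functions over the overlap.
      let f : Fn T (U δ ⊓ U δ') →+* Fn S V :=
        (Fn.res (le_inf hV hV' : V ≤ preim h (U δ ⊓ U δ'))).comp (Fn.comap h _)
      have h1 := congrArg (fun M => M.map f) (hE.cocycle δ δ' inf_le_left inf_le_right)
      rw [Matrix.map_mul] at h1
      have h3 : ∀ a, f (Fn.res inf_le_left a) = Fn.res hV (Fn.comap h (U δ) a) := fun a =>
        Fn.res_comap_res h (W := U δ ⊓ U δ') inf_le_left (le_inf hV hV') hV a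
      have h4 : ∀ a, f (Fn.res inf_le_right a) = Fn.res hV' (Fn.comap h (U δ') a) := fun a =>
        Fn.res_comap_res h (W := U δ ⊓ U δ') inf_le_right (le_inf hV hV') hV' a
      simpa only [Matrix.map_map, Matrix.submatrix_map, Function.comp_def, h3, h4] using h1)
  -- Regarded as sections of `h_* E'`, the `φ'_j` satisfy the relations given by `A`. The adjoint of
  -- the resulting `η` is `χ : h^* E ⟶ E'`. In the other direction, `ψ` needs only the relations
  -- `hcoord` in `h^* E`.
  obtain ⟨η, hη⟩ := hE.exists_hom (F := (pushforward h).obj E') (f := φ') hE'.coord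
  obtain ⟨ψ, hψ⟩ := hE'.exists_hom hcoord
  let χ := ((pullbackPushforwardAdj h).homEquiv E E').symm η
  have hχ : ∀ j, Sec.map χ ⊤ (pullbackSection h (φ j)) = φ' j := fun j => by
    refine (sec_map_homEquiv h χ (φ j)).symm.trans ?_
    rw [Equiv.apply_symm_apply]
    exact hη j
  refine hE'.of_iso ⟨ψ, χ, hE'.generates.hom_ext fun j => ?_, ?_⟩ hψ
  · change Sec.map χ ⊤ (Sec.map ψ ⊤ (φ' j)) = φ' j
    rw [hψ, hχ]
  -- It is not yet known that the `h^* φ_j` generate `h^* E`; the equality is therefore tested after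
  -- adjunction, on the generators of `E`.
  · refine ((pullbackPushforwardAdj h).homEquiv E _).injective
      (hE.generates.hom_ext fun j => ?_)
    refine (sec_map_homEquiv h (χ ≫ ψ) (φ j)).trans
      (Eq.trans ?_ (sec_map_homEquiv h (𝟙 _) (φ j)).symm)
    change Sec.map ψ ⊤ (Sec.map χ ⊤ (pullbackSection h (φ j))) = pullbackSection h (φ j)
    rw [hχ, hψ]

end Pullback

end RingedSpaceOver

/-! ### The top exterior power of a free module. -/

section ExteriorPower
variable {R M : Type*} [CommRing R] [AddCommGroup M] [Module R M] {r : ℕ}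

/-- Both sides are alternating in `v`, so it suffices to take `v` an injective family of basis
vectors, that is, a permutation of `b`; both sides are then multiplied by its sign. -/
theorem ιMulti_eq_det_smul (b : Module.Basis (Fin r) R M) (v : Fin r → M) :
    exteriorPower.ιMulti R r v = b.det v • exteriorPower.ιMulti R r b := by
  have : exteriorPower.ιMulti R r (M := M) =
      (LinearMap.toSpanSingleton R _ (exteriorPower.ιMulti R r b)).compAlternatingMap b.det := by
    refine Module.Basis.ext_alternating b fun v hv => ?_
    let σ : Equiv.Perm (Fin r) := Equiv.ofBijective v (Finite.injective_iff_bijective.mp hv)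
    change (exteriorPower.ιMulti R r) (fun i => b (σ i)) = _
    have h1 := (exteriorPower.ιMulti R r (M := M)).map_perm b σ
    have h2 := b.det.map_perm b σ
    change _ = b.det (fun i => b (σ i)) • exteriorPower.ιMulti R r b
    change (exteriorPower.ιMulti R r) (fun i => b (σ i)) = _ at h1
    change b.det (fun i => b (σ i)) = _ at h2
    rw [h1, h2, b.det_self, smul_assoc, one_smul]
  exact DFunLike.congr_fun this v

/-- The determinant induces a linear form `L` on `⋀^r M` with `ω = L ω • (b_1 ∧ ... ∧ b_r)`, so `⋀^r
M` is free of rank one. In this coordinate the map is multiplication by `b.det v`. -/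
theorem bijective_smul_ιMulti_iff (b : Module.Basis (Fin r) R M) (v : Fin r → M) :
    Function.Bijective (fun a : R => a • exteriorPower.ιMulti R r v) ↔ IsUnit (b.det v) := by
  let L : ⋀[R]^r M →ₗ[R] R := exteriorPower.alternatingMapLinearEquiv b.det
  have hL : ∀ w, L (exteriorPower.ιMulti R r w) = b.det w := fun w =>
    exteriorPower.alternatingMapLinearEquiv_apply_ιMulti _ _
  have hω : ∀ ω, ω = L ω • exteriorPower.ιMulti R r b := by
    have : LinearMap.id =
        (LinearMap.toSpanSingleton R _ (exteriorPower.ιMulti R r b)).comp L := by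
      refine exteriorPower.linearMap_ext (AlternatingMap.ext fun w => ?_)
      change exteriorPower.ιMulti R r w =
        L (exteriorPower.ιMulti R r w) • exteriorPower.ιMulti R r b
      rw [hL]
      exact ιMulti_eq_det_smul b w
    exact fun ω => DFunLike.congr_fun this ω
  constructor
  · rintro ⟨-, h⟩
    obtain ⟨a, ha⟩ := h (exteriorPower.ιMulti R r b)
    have h1 := congrArg L ha
    simp only [map_smul, hL, b.det_self, smul_eq_mul] at h1
    exact IsUnit.of_mul_eq_one a (by rw [mul_comm, h1])
  · rintro ⟨d, hd⟩
    refine ⟨fun a a' h => ?_, fun ω => ⟨L ω * ↑d⁻¹, ?_⟩⟩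
    · have h1 := congrArg L h
      simp only [map_smul, hL, smul_eq_mul, ← hd] at h1
      exact d.isUnit.mul_left_injective h1
    · change (L ω * ↑d⁻¹) • exteriorPower.ιMulti R r v = ω
      rw [ιMulti_eq_det_smul b, ← hd, smul_smul, mul_assoc, Units.inv_mul, mul_one, ← hω]

end ExteriorPower

/-! ### Stalks, local bases and the locus where the wedge of sections is a generator. -/

namespace RingedSpaceOver
variable {k : Type u} [CommRing k] {S T : RingedSpaceOver k}

section Stalks
variable {E : S.Modules} {U V : Opens S.space} {x : S.space}

/-- The germ of a function. -/
def Fn.germ (hx : x ∈ U) : Fn S U →+* stalkRing S x :=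
  (S.toRingedSpace.presheaf.germ U x hx).hom

/-- The germ of a section. -/
def Sec.germ (hx : x ∈ U) : Sec E U →+ stalkModule E x :=
  (TopCat.Presheaf.germ (C := Ab.{u}) (X := S.space) E.val.presheaf U x hx).hom

theorem Fn.germ_res (h : V ≤ U) (hx : x ∈ V) (a : Fn S U) :
    Fn.germ hx (Fn.res h a) = Fn.germ (h hx) a :=
  TopCat.Presheaf.germ_res_apply S.toRingedSpace.presheaf (homOfLE h) x hx a

theorem Sec.germ_res (h : V ≤ U) (hx : x ∈ V) (s : Sec E U) :
    Sec.germ hx (Sec.res h s) = Sec.germ (h hx) s :=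
  TopCat.Presheaf.germ_res_apply (C := Ab.{u}) (X := S.space) E.val.presheaf (homOfLE h) x hx s

theorem Sec.germ_smul (hx : x ∈ U) (a : Fn S U) (s : Sec E U) :
    Sec.germ hx (a • s) = Fn.germ hx a • Sec.germ hx s :=
  PresheafOfModules.germ_smul (X := S.space) (R := S.toRingedSpace.presheaf) E.val x U hx a s

theorem Fn.exists_germ (g : stalkRing S x) :
    ∃ (V : Opens S.space) (hx : x ∈ V) (a : Fn S V), Fn.germ hx a = g :=
  TopCat.Presheaf.exists_germ_eq S.toRingedSpace.presheaf g

theorem Sec.exists_germ (g : stalkModule E x) :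
    ∃ (V : Opens S.space) (hx : x ∈ V) (s : Sec E V), Sec.germ hx s = g :=
  TopCat.Presheaf.exists_germ_eq (C := Ab.{u}) (X := S.space) E.val.presheaf g

theorem Sec.exists_res_eq_of_germ_eq (hx : x ∈ U) (s t : Sec E U)
    (h : Sec.germ hx s = Sec.germ hx t) :
    ∃ (V : Opens S.space) (_ : x ∈ V) (hV : V ≤ U), Sec.res hV s = Sec.res hV t := by
  obtain ⟨W, hxW, i, j, hij⟩ :=
    TopCat.Presheaf.germ_eq (C := Ab.{u}) (X := S.space) E.val.presheaf x hx hx s t h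
  exact ⟨W, hxW, i.le, hij⟩

theorem Fn.exists_germ_family {m : ℕ} (g : Fin m → stalkRing S x) (hx : x ∈ U) :
    ∃ (V : Opens S.space) (hV : x ∈ V) (_ : V ≤ U) (a : Fin m → Fn S V),
      ∀ i, Fn.germ hV (a i) = g i := by
  choose W hxW a ha using fun i => Fn.exists_germ (g i)
  have hxV : x ∈ U ⊓ Finset.univ.inf W := by
    refine ⟨hx, ?_⟩
    rw [Opens.coe_finset_inf]
    simpa using hxW
  have hle : ∀ i, U ⊓ Finset.univ.inf W ≤ W i := fun i =>
    inf_le_right.trans (Finset.inf_le (Finset.mem_univ i))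
  exact ⟨_, hxV, inf_le_left, fun i => Fn.res (hle i) (a i), fun i => by rw [Fn.germ_res, ha]⟩

/-- Sections on `U` form a basis if they form a basis of the sections on every `V ≤ U`. -/
def IsBasisOn {m : ℕ} (e : Fin m → Sec E U) : Prop :=
  ∀ (V : Opens S.space) (hV : V ≤ U),
    Function.Bijective (fun a : Fin m → Fn S V => ∑ i, a i • Sec.res hV (e i))

theorem IsBasisOn.res {m : ℕ} {e : Fin m → Sec E U} (he : IsBasisOn e) (h : V ≤ U) :
    IsBasisOn fun i => Sec.res h (e i) := fun W hW => by
  simpa only [Sec.res_res] using he W (hW.trans h)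

theorem isBasisOn_res_iff {m : ℕ} {s : Fin m → Sec E ⊤} :
    (IsBasisOn fun i => (Sec.res le_top (s i) : Sec E V)) ↔
      ∀ W ≤ V, Function.Bijective fun a : Fin m → Fn S W => Sec.comb s a := by
  simp only [IsBasisOn, Sec.res_res]
  rfl

theorem Sec.germ_sum_smul {m : ℕ} (hx : x ∈ U) (a : Fin m → Fn S U) (e : Fin m → Sec E U) :
    Sec.germ hx (∑ i, a i • e i) = ∑ i, Fn.germ hx (a i) • Sec.germ hx (e i) := by
  simp only [map_sum, Sec.germ_smul]

/-- Finitely many germs have representatives on a common neighbourhood, and a relation between germs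
holds on a neighbourhood; on open subsets of `U` the `e_i` form a basis. -/
theorem IsBasisOn.exists_stalk_basis {m : ℕ} {e : Fin m → Sec E U} (he : IsBasisOn e)
    (hx : x ∈ U) :
    ∃ b : Module.Basis (Fin m) (stalkRing S x) (stalkModule E x), ∀ i, b i = Sec.germ hx (e i) := by
  have hli : LinearIndependent (stalkRing S x) fun i => Sec.germ hx (e i) := by
    refine Fintype.linearIndependent_iff.mpr fun g hg i => ?_
    obtain ⟨V, hxV, hV, a, ha⟩ := Fn.exists_germ_family g hx
    have h1 : Sec.germ hxV (∑ i, a i • Sec.res hV (e i)) = Sec.germ hxV 0 := by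
      rw [Sec.germ_sum_smul, map_zero, ← hg]
      simp only [ha, Sec.germ_res]
    obtain ⟨W, hxW, hW, h2⟩ := Sec.exists_res_eq_of_germ_eq hxV _ _ h1
    rw [Sec.res_sum_smul, map_zero] at h2
    have h3 : (fun i => Fn.res hW (a i)) = 0 := by
      refine (he W (hW.trans hV)).1 ?_
      simpa [Sec.res_res] using h2
    rw [← ha i, ← Fn.germ_res hW hxW]
    exact (congrArg _ (congrFun h3 i)).trans (map_zero _)
  have hsp : ⊤ ≤ Submodule.span (stalkRing S x) (Set.range fun i => Sec.germ hx (e i)) := by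
    intro g _
    obtain ⟨V, hxV, s, rfl⟩ := Sec.exists_germ g
    obtain ⟨a, ha⟩ := (he (V ⊓ U) inf_le_right).2 (Sec.res inf_le_left s)
    have hxVU : x ∈ V ⊓ U := ⟨hxV, hx⟩
    rw [← Sec.germ_res (inf_le_left : V ⊓ U ≤ V) hxVU s, ← ha]
    simp only [Sec.germ_sum_smul, Sec.germ_res]
    exact Submodule.sum_mem _ fun i _ => Submodule.smul_mem _ _ (Submodule.subset_span ⟨i, rfl⟩)
  exact ⟨Module.Basis.mk hli hsp, fun i => Module.Basis.mk_apply hli hsp i⟩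

/-- Coordinates in a basis are unique, so the coordinates of a section found on the pieces of a
covering agree on overlaps and glue. -/
theorem isBasisOn_of_locally {m : ℕ} {e : Fin m → Sec E U}
    (h : ∀ x ∈ U, ∃ (V : Opens S.space) (_ : x ∈ V) (hV : V ≤ U),
      IsBasisOn fun i => Sec.res hV (e i)) : IsBasisOn e := by
  choose W hxW hW hb using h
  intro V hV
  constructor
  · intro a b hab
    funext i
    refine Fn.eq_of_locally fun x hx => ⟨V ⊓ W x (hV hx), ⟨hx, hxW _ _⟩, inf_le_left, ?_⟩
    refine congrFun ((hb x (hV hx) _ inf_le_right).1 (?_ :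
      (∑ i, Fn.res inf_le_left (a i) • Sec.res inf_le_right (Sec.res _ (e i))) =
        ∑ i, Fn.res inf_le_left (b i) • Sec.res inf_le_right (Sec.res _ (e i)))) i
    have := congrArg (Sec.res (inf_le_left : V ⊓ W x (hV hx) ≤ V)) hab
    simpa only [Sec.res_sum_smul, Sec.res_res] using this
  · intro s
    choose a ha using fun x : V => (hb x.1 (hV x.2) (V ⊓ W x.1 (hV x.2)) inf_le_right).2
      (Sec.res inf_le_left s)
    have : ∀ i, ∃ c : Fn S V, ∀ x : V, Fn.res inf_le_left c = a x i := fun i => by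
      refine Fn.exists_glue (fun x : V => V ⊓ W x.1 (hV x.2)) (fun x => inf_le_left)
        (fun x hx => ⟨⟨x, hx⟩, hx, hxW _ _⟩) (fun x => a x i) fun x y => ?_
      refine congrFun (f := fun i => Fn.res inf_le_left (a x i))
        (g := fun i => Fn.res inf_le_right (a y i))
        ((hb x.1 (hV x.2) _ (inf_le_left.trans inf_le_right)).1 ?_) i
      have h1 := congrArg (Sec.res (inf_le_left : _ ⊓ (V ⊓ W y.1 (hV y.2)) ≤ _)) (ha x)
      have h2 := congrArg (Sec.res (inf_le_right : (V ⊓ W x.1 (hV x.2)) ⊓ _ ≤ _)) (ha y)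
      simp only [Sec.res_sum_smul, Sec.res_res] at h1 h2 ⊢
      exact h1.trans h2.symm
    choose c hc using this
    refine ⟨c, Sec.eq_of_locally fun x hx => ⟨V ⊓ W x (hV hx), ⟨hx, hxW _ _⟩, inf_le_left, ?_⟩⟩
    have h1 := ha ⟨x, hx⟩
    simp only [Sec.res_res] at h1
    simp only [Sec.res_sum_smul, Sec.res_res, ← h1]
    exact Finset.sum_congr rfl fun i _ => by rw [hc i ⟨x, hx⟩]

theorem IsBasisOn.of_matrix {m : ℕ} {e s : Fin m → Sec E U} (he : IsBasisOn e)
    (M : Matrix (Fin m) (Fin m) (Fn S U)) (hM : IsUnit M.det)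
    (hs : ∀ i, s i = ∑ l, M l i • e l) : IsBasisOn s := by
  intro V hV
  have hM' : IsUnit (M.map (Fn.res hV)) :=
    ((Matrix.isUnit_iff_isUnit_det M).mpr hM).map (Fn.res hV).mapMatrix
  obtain ⟨N, hN⟩ := hM'
  have h1 : Function.Bijective (M.map (Fn.res hV)).mulVec := by
    refine Function.bijective_iff_has_inverse.mpr ⟨(N⁻¹).1.mulVec, fun v => ?_, fun v => ?_⟩
    · rw [← hN, Matrix.mulVec_mulVec, Units.inv_mul, Matrix.one_mulVec]
    · rw [← hN, Matrix.mulVec_mulVec, Units.mul_inv, Matrix.one_mulVec]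
  convert (he V hV).comp h1 using 1
  funext a
  simp only [Function.comp_apply, hs, Sec.res_sum_smul, Matrix.mulVec, dotProduct, Matrix.map_apply,
    Finset.smul_sum, Finset.sum_smul, smul_smul]
  rw [Finset.sum_comm]
  simp only [mul_comm]

/-- In a local basis `e` the sections `s` have a square matrix of coordinates, and the wedge
condition says that the germ of its determinant is a unit. Then the determinant is a unit near `x`,
where `s` is another basis. -/
theorem exists_isBasisOn_of_mem_wedgeLocus {m : ℕ} (hE : IsLocallyFreeOfRank E m)
    {s : Fin m → Sec E ⊤} (hx : x ∈ wedgeLocus E s) :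
    ∃ V : Opens S.space, x ∈ V ∧ IsBasisOn fun i => (Sec.res le_top (s i) : Sec E V) := by
  obtain ⟨U, hxU, e, he⟩ : ∃ U, x ∈ U ∧ ∃ e : Fin m → Sec E U, IsBasisOn e := hE x
  obtain ⟨b, hb⟩ := he.exists_stalk_basis hxU
  choose M hM using fun i => (he U le_rfl).2 (Sec.res le_top (s i))
  simp only [Sec.res_self] at hM
  have hgerm : ∀ i, RingedSpaceOver.germ E x (s i) =
      ∑ l, Fn.germ hxU (M i l) • b l := fun i => by
    simp only [hb, ← Sec.germ_sum_smul, hM, Sec.germ_res]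
    rfl
  let M' : Matrix (Fin m) (Fin m) (Fn S U) := fun l i => M i l
  have hdet : b.det (fun i => RingedSpaceOver.germ E x (s i)) = Fn.germ hxU M'.det := by
    rw [Module.Basis.det_apply, RingHom.map_det]
    congr 1
    ext l i
    rw [Module.Basis.toMatrix_apply, hgerm]
    simp [M', Finsupp.single_apply]
    rfl
  have hu := (bijective_smul_ιMulti_iff b _).mp hx
  rw [hdet] at hu
  -- An inverse of a germ extends to a neighbourhood; the stalks do not have to be local rings.
  obtain ⟨V, i, hxV, hV⟩ :=
    RingedSpace.isUnit_res_of_isUnit_germ S.toRingedSpace U M'.det x hxU hu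
  have hV : IsUnit (Fn.res i.le M'.det) := hV
  refine ⟨V, hxV, IsBasisOn.of_matrix (e := fun l => Sec.res i.le (e l)) (he.res i.le)
    (M'.map (Fn.res i.le)) (by rwa [RingHom.map_det] at hV) fun j => ?_⟩
  rw [← Sec.res_res le_top i.le, ← hM j, Sec.res_sum_smul]
  rfl

theorem comb_bijective_of_subset_wedgeLocus {m : ℕ} (hE : IsLocallyFreeOfRank E m)
    {s : Fin m → Sec E ⊤} (hU : (U : Set S.space) ⊆ wedgeLocus E s) :
    ∀ V ≤ U, Function.Bijective fun a : Fin m → Fn S V => Sec.comb s a := by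
  refine isBasisOn_res_iff.mp (isBasisOn_of_locally fun x hx => ?_)
  obtain ⟨V, hxV, hV⟩ := exists_isBasisOn_of_mem_wedgeLocus hE (hU hx)
  refine ⟨U ⊓ V, ⟨hx, hxV⟩, inf_le_left, ?_⟩
  have h1 := hV.res (inf_le_right : U ⊓ V ≤ V)
  simp only [Sec.res_res] at h1 ⊢
  exact h1

theorem mem_wedgeLocus_of_isBasisOn {m : ℕ} {s : Fin m → Sec E ⊤} {V : Opens S.space}
    (hx : x ∈ V) (hs : IsBasisOn fun i => (Sec.res le_top (s i) : Sec E V)) :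
    x ∈ wedgeLocus E s := by
  obtain ⟨b, hb⟩ := hs.exists_stalk_basis hx
  have h : (fun i => RingedSpaceOver.germ E x (s i)) = b := funext fun i =>
    ((hb i).trans (Sec.germ_res _ hx _)).symm
  refine (bijective_smul_ιMulti_iff b _).mpr ?_
  rw [h, b.det_self]
  exact isUnit_one

end Stalks

end RingedSpaceOver

namespace QuotientDatum
open RingedSpaceOver
variable {k : Type u} [CommRing k] {r n : ℕ} {S : RingedSpaceOver k}

theorem isAlgTopQuotient_of_isFramed {θ : QuotientDatum r n S}
    {A : ∀ δ, Matrix (Fin r) (Fin n) (Fn S (θ.U δ))} (h : IsFramed θ.E θ.φ θ.U A) :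
    θ.IsAlgTopQuotient := by
  have hb : ∀ δ, IsBasisOn fun i => (Sec.res le_top (θ.φ (δ.emb i)) : Sec θ.E (θ.U δ)) :=
    fun δ => isBasisOn_res_iff.mpr (h.basis δ)
  refine ⟨fun x => ?_, h.covers, fun δ x hx => mem_wedgeLocus_of_isBasisOn hx (hb δ)⟩
  obtain ⟨δ, hδ⟩ := h.covers x
  exact ⟨θ.U δ, hδ, _, hb δ⟩

theorem IsAlgTopQuotient.exists_isFramed {θ : QuotientDatum r n S} (h : θ.IsAlgTopQuotient) :
    ∃ A : ∀ δ, Matrix (Fin r) (Fin n) (Fn S (θ.U δ)), IsFramed θ.E θ.φ θ.U A := by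
  have hb : ∀ δ, ∀ V ≤ θ.U δ, Function.Bijective
      (fun a : Fin r → Fn S V => Sec.comb (E := θ.E) (fun i => θ.φ (δ.emb i)) a) := by
    exact fun δ => comb_bijective_of_subset_wedgeLocus h.locallyFree (h.subset_locus δ)
  choose A hA using fun δ j => (hb δ (θ.U δ) le_rfl).2 (Sec.res le_top (θ.φ j))
  exact ⟨fun δ i j => A δ j i, h.covers, hb, fun δ j => (hA δ j).symm⟩

end QuotientDatum

/-! ### Invariants and equivariant vectors at a point of the poset. -/

section Invariants
variable {k : Type u} [CommRing k] {r n : ℕ} {B : Type*} [CommRing B] [Algebra k B]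

instance : IsScalarTower k (MvPolynomial (Fin r × Fin r) k) (GLRing k r) :=
  inferInstanceAs (IsScalarTower k (MvPolynomial (Fin r × Fin r) k)
    (Localization.Away (Matrix.mvPolynomialX (Fin r) (Fin r) k).det))

/-- The morphism of algebras from `k[x_ij]_det` that sends the generic matrix to a given invertible
matrix. -/
def GLRing.eval (M : Matrix (Fin r) (Fin r) B) (hM : IsUnit M.det) : GLRing k r →ₐ[k] B :=
  IsLocalization.liftAlgHom
    (M := Submonoid.powers (Matrix.mvPolynomialX (Fin r) (Fin r) k).det)
    (f := MvPolynomial.aeval fun p => M p.1 p.2) (by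
      rintro ⟨_, m, rfl⟩
      change IsUnit (MvPolynomial.aeval (R := k) (fun p : Fin r × Fin r => M p.1 p.2)
        ((Matrix.mvPolynomialX (Fin r) (Fin r) k).det ^ m))
      rw [map_pow, AlgHom.map_det]
      refine IsUnit.pow m ?_
      convert hM
      ext i j
      simp)

theorem GLRing.eval_gen (M : Matrix (Fin r) (Fin r) B) (hM : IsUnit M.det) (i j : Fin r) :
    GLRing.eval (k := k) M hM (GLRing.gen k r i j) = M i j := by
  refine (IsLocalization.lift_eq _ _).trans ?_
  simp

theorem aeval_minor (A : Matrix (Fin r) (Fin n) B) (δ : RSubset r n) :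
    MvPolynomial.aeval (fun p : Fin r × Fin n => A p.1 p.2) (minor k δ) =
      (A.submatrix id δ.emb).det := by
  rw [minor, AlgHom.map_det]
  congr 1
  ext i j
  simp

/-- The morphism of algebras from a localization of `k[X_ij]` by minors that sends the generic matrix
to a given matrix. -/
def EpimRing.eval (D : Set (RSubset r n)) (A : Matrix (Fin r) (Fin n) B)
    (hA : ∀ δ ∈ D, IsUnit (A.submatrix id δ.emb).det) : EpimRing k D →ₐ[k] B :=
  IsLocalization.liftAlgHom (M := minors k D)
    (f := MvPolynomial.aeval fun p : Fin r × Fin n => A p.1 p.2) (by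
      have : minors k D ≤ (IsUnit.submonoid B).comap
          (MvPolynomial.aeval (R := k) fun p : Fin r × Fin n => A p.1 p.2) := by
        refine Submonoid.closure_le.mpr ?_
        rintro _ ⟨δ, hδ, rfl⟩
        change IsUnit (MvPolynomial.aeval _ (minor k δ))
        rw [aeval_minor]
        exact hA δ hδ
      exact fun y => this y.2)

variable (k) in
/-- The generic matrix, over a localization of `k[X_ij]` by minors. -/
def EpimRing.gen (D : Set (RSubset r n)) : Matrix (Fin r) (Fin n) (EpimRing k D) :=
  fun i j => algebraMap (HomRing k r n) (EpimRing k D) (MvPolynomial.X (i, j))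

theorem EpimRing.eval_gen (D : Set (RSubset r n)) (A : Matrix (Fin r) (Fin n) B)
    (hA : ∀ δ ∈ D, IsUnit (A.submatrix id δ.emb).det) (i : Fin r) (j : Fin n) :
    EpimRing.eval (k := k) D A hA (EpimRing.gen k D i j) = A i j := by
  refine (IsLocalization.lift_eq _ _).trans ?_
  simp

theorem EpimRing.hom_ext {D : Set (RSubset r n)} {f g : EpimRing k D →ₐ[k] B}
    (h : ∀ i j, f (EpimRing.gen k D i j) = g (EpimRing.gen k D i j)) : f = g :=
  EpimRing.algHom_ext fun p => h p.1 p.2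

theorem EpimRing.isUnit_det {D : Set (RSubset r n)} {δ : RSubset r n} (hδ : δ ∈ D) :
    IsUnit ((EpimRing.gen k D).submatrix id δ.emb).det := by
  have h1 : IsUnit (algebraMap (HomRing k r n) (EpimRing k D) (minor k δ)) :=
    IsLocalization.map_units (EpimRing k D)
      (⟨_, Submonoid.subset_closure ⟨δ, hδ, rfl⟩⟩ : minors k D)
  rw [minor, RingHom.map_det] at h1
  exact h1

theorem coact_gen (D : Set (RSubset r n)) :
    (EpimRing.gen k D).map (coact k D) =
      (GLRing.gen k r).map
          (Algebra.TensorProduct.includeRight : GLRing k r →ₐ[k] EpimRing k D ⊗[k] GLRing k r) *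
        (EpimRing.gen k D).map (Algebra.TensorProduct.includeLeft :
          EpimRing k D →ₐ[k] EpimRing k D ⊗[k] GLRing k r) := by
  ext i j
  simp only [Matrix.map_apply, EpimRing.gen, coact_algebraMap, Matrix.mul_apply]
  simp [coactPoly]

/-- On points with values in `B`, the coaction is the action: composed with the point `(M, A)` of
`GL_r × Epim` it is evaluation at `M * A`. It is enough to compare the images of the generic matrix.
-/
theorem lift_coact {D : Set (RSubset r n)} (A : Matrix (Fin r) (Fin n) B)
    (hA : ∀ δ ∈ D, IsUnit (A.submatrix id δ.emb).det)
    (M : Matrix (Fin r) (Fin r) B) (hM : IsUnit M.det)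
    (hMA : ∀ δ ∈ D, IsUnit ((M * A).submatrix id δ.emb).det) (a : EpimRing k D) :
    Algebra.TensorProduct.lift (EpimRing.eval D A hA) (GLRing.eval M hM)
      (fun _ _ => Commute.all _ _) (coact k D a) = EpimRing.eval D (M * A) hMA a := by
  refine DFunLike.congr_fun (f := (Algebra.TensorProduct.lift (EpimRing.eval D A hA)
    (GLRing.eval M hM) (fun _ _ => Commute.all _ _)).comp (coact k D))
    (EpimRing.hom_ext fun i j => ?_) a
  have := congrFun (congrFun (coact_gen (k := k) D) i) j
  rw [Matrix.map_apply] at this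
  rw [AlgHom.comp_apply, this, EpimRing.eval_gen, Matrix.mul_apply, Matrix.mul_apply, map_sum]
  refine Finset.sum_congr rfl fun l _ => ?_
  simp [EpimRing.eval_gen, GLRing.eval_gen, mul_comm]

/-- The values of an invariant at a matrix are not changed by the action of an invertible matrix. -/
theorem eval_mul_of_mem_invariants {D : Set (RSubset r n)} {A A' : Matrix (Fin r) (Fin n) B}
    (hA : ∀ δ ∈ D, IsUnit (A.submatrix id δ.emb).det)
    (hA' : ∀ δ ∈ D, IsUnit (A'.submatrix id δ.emb).det)
    (M : Matrix (Fin r) (Fin r) B) (hM : IsUnit M.det) (h : A' = M * A) (a : invariants k D) :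
    EpimRing.eval D A' hA' a.1 = EpimRing.eval D A hA a.1 := by
  subst h
  have ha : coact k D a.1 = a.1 ⊗ₜ[k] 1 := a.2
  rw [← lift_coact A hA M hM hA', ha]
  simp

/-- If `b` is the inverse of an invariant `a`, then `coact k D b` and `b ⊗ 1` are both inverse to `a
⊗ 1`, hence equal. -/
theorem isUnit_of_isUnit_coe {D : Set (RSubset r n)} {a : invariants k D} (h : IsUnit a.1) :
    IsUnit a := by
  obtain ⟨b, hb⟩ := h.exists_right_inv
  have ha : coact k D a.1 = a.1 ⊗ₜ[k] 1 := a.2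
  have h1 : a.1 ⊗ₜ[k] (1 : GLRing k r) * coact k D b = 1 := by
    rw [← ha, ← map_mul, hb, map_one]
  have h2 : a.1 ⊗ₜ[k] (1 : GLRing k r) * b ⊗ₜ[k] 1 = 1 := by
    rw [Algebra.TensorProduct.tmul_mul_tmul, hb, one_mul, Algebra.TensorProduct.one_def]
  have hu : IsUnit (a.1 ⊗ₜ[k] (1 : GLRing k r)) := IsUnit.of_mul_eq_one _ h2
  have hb' : b ∈ invariants k D := hu.mul_left_cancel (h1.trans h2.symm)
  exact IsUnit.of_mul_eq_one ⟨b, hb'⟩ (Subtype.ext hb)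

/-- A vector is invariant if its product with the generic square matrix is equivariant. -/
theorem mem_invariants_of_mulVec {D : Set (RSubset r n)} {δ : RSubset r n} (hδ : δ ∈ D)
    (v : equivariantVectors k D) {w : Fin r → EpimRing k D}
    (h : ((EpimRing.gen k D).submatrix id δ.emb).mulVec w = v.1) (i : Fin r) :
    w i ∈ invariants k D := by
  let a : EpimRing k D →ₐ[k] EpimRing k D ⊗[k] GLRing k r := Algebra.TensorProduct.includeLeft
  let b : GLRing k r →ₐ[k] EpimRing k D ⊗[k] GLRing k r := Algebra.TensorProduct.includeRight
  let P := (EpimRing.gen k D).submatrix id δ.emb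
  -- The generic square block transforms as `P ↦ g P`, exactly as an equivariant vector does.
  have hP : P.map (coact k D) = (GLRing.gen k r).map b * P.map a := by
    have := congrArg (fun M => M.submatrix id δ.emb) (coact_gen (k := k) D)
    exact this
  have h1 : (P.map (coact k D)).mulVec (fun i => coact k D (w i)) =
      ((GLRing.gen k r).map b).mulVec (fun i => a (v.1 i)) := by
    funext i
    have hv : coact k D (v.1 i) = ∑ j, v.1 j ⊗ₜ[k] GLRing.gen k r i j := v.2 i
    have hw := congrArg (coact k D) (congrFun h i)
    rw [hv, Matrix.mulVec, dotProduct, map_sum] at hw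
    simp only [map_mul] at hw
    refine hw.trans ?_
    simp [Matrix.mulVec, dotProduct, a, b]
  have h2 : (fun i => a (v.1 i)) = (P.map a).mulVec (fun i => a (w i)) := by
    funext i
    rw [← congrFun h i, Matrix.mulVec, dotProduct, map_sum]
    simp [Matrix.mulVec, dotProduct, P]
  rw [h2, Matrix.mulVec_mulVec, ← hP] at h1
  -- At this point `coact(P) * coact(w) = coact(P) * (w ⊗ 1)`; the factor `coact(P)` can be
  -- cancelled since `det_δ` is inverted at `D`.
  have hu : IsUnit (P.map (coact k D)) :=
    ((Matrix.isUnit_iff_isUnit_det P).mpr (EpimRing.isUnit_det hδ)).map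
      (coact k D).toRingHom.mapMatrix
  obtain ⟨Q, hQ⟩ := hu
  have h3 := congrArg (Q⁻¹).1.mulVec h1
  rw [← hQ, Matrix.mulVec_mulVec, Matrix.mulVec_mulVec, Units.inv_mul, Matrix.one_mulVec,
    Matrix.one_mulVec] at h3
  exact congrFun h3 i

theorem column_comb_val {m : ℕ} {D : Set (RSubset r n)} (f : Fin m → Fin n)
    (a : Fin m → invariants k D) :
    (∑ l, a l • column k r D (f l) : equivariantVectors k D).1 =
      ((EpimRing.gen k D).submatrix id f).mulVec fun l => (a l).1 := by
  funext i
  rw [AddSubmonoidClass.coe_finsetSum, Finset.sum_apply]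
  refine Finset.sum_congr rfl fun l _ => ?_
  exact mul_comm _ _

/-- The columns with indices in `δ` form a basis of the equivariant vectors. -/
theorem column_comb_bijective {D : Set (RSubset r n)} {δ : RSubset r n} (hδ : δ ∈ D) :
    Function.Bijective fun a : Fin r → invariants k D =>
      (∑ l, a l • column k r D (δ.emb l) : equivariantVectors k D) := by
  obtain ⟨Q, hQ⟩ := (Matrix.isUnit_iff_isUnit_det _).mpr (EpimRing.isUnit_det (k := k) hδ)
  constructor
  · intro a b hab
    have h1 := congrArg Subtype.val hab
    simp only [column_comb_val] at h1
    have h2 := congrArg (Q⁻¹).1.mulVec h1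
    rw [← hQ, Matrix.mulVec_mulVec, Matrix.mulVec_mulVec, Units.inv_mul, Matrix.one_mulVec,
      Matrix.one_mulVec] at h2
    exact funext fun i => Subtype.ext (congrFun h2 i)
  · intro v
    -- By Cramer's rule the coordinates of `v` are `(X)_δ⁻¹ * v`; they are invariant by
    -- `mem_invariants_of_mulVec`.
    have h1 : ((EpimRing.gen k D).submatrix id δ.emb).mulVec ((Q⁻¹).1.mulVec v.1) = v.1 := by
      rw [← hQ, Matrix.mulVec_mulVec, Units.mul_inv, Matrix.one_mulVec]
    refine ⟨fun i => ⟨_, mem_invariants_of_mulVec hδ v h1 i⟩, Subtype.ext ?_⟩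
    rw [column_comb_val]
    exact h1

variable (k) in
/-- The matrix of the coordinates of the columns in the basis of the columns with indices in `δ`. -/
def affineCoords {D : Set (RSubset r n)} {δ : RSubset r n} (hδ : δ ∈ D) :
    Matrix (Fin r) (Fin n) (invariants k D) :=
  fun i j => ((column_comb_bijective hδ).2 (column k r D j)).choose i

theorem column_comb_affineCoords {D : Set (RSubset r n)} {δ : RSubset r n} (hδ : δ ∈ D)
    (j : Fin n) :
    (∑ l, affineCoords k hδ l j • column k r D (δ.emb l) : equivariantVectors k D) =
      column k r D j :=
  ((column_comb_bijective hδ).2 (column k r D j)).choose_spec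

/-- As the block `(X)_δ` is invertible, this identifies the affine coordinates with the entries of
`(X)_δ⁻¹ * X`. -/
theorem gen_mul_affineCoords {D : Set (RSubset r n)} {δ : RSubset r n} (hδ : δ ∈ D) :
    (EpimRing.gen k D).submatrix id δ.emb * (affineCoords k hδ).map (invariants k D).val =
      EpimRing.gen k D := by
  ext i j
  have := congrFun (congrArg Subtype.val (column_comb_affineCoords (k := k) hδ j)) i
  rw [column_comb_val] at this
  exact this

/-- The minor of `(X)_δ⁻¹ * X` at `δ'` is `det_δ' / det_δ`, a unit of the localization; its inverse
is again invariant. -/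
theorem isUnit_det_affineCoords {D : Set (RSubset r n)} {δ δ' : RSubset r n} (hδ : δ ∈ D)
    (hδ' : δ' ∈ D) : IsUnit ((affineCoords k hδ).submatrix id δ'.emb).det := by
  refine isUnit_of_isUnit_coe ?_
  have h1 := congrArg (fun M => (M.submatrix id δ'.emb).det) (gen_mul_affineCoords (k := k) hδ)
  change (((EpimRing.gen k D).submatrix id δ.emb) *
    (((affineCoords k hδ).map (invariants k D).val).submatrix id δ'.emb)).det = _ at h1
  rw [Matrix.det_mul] at h1
  have h2 := isUnit_of_mul_isUnit_right (h1 ▸ EpimRing.isUnit_det (k := k) hδ')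
  have h3 := AlgHom.map_det (invariants k D).val ((affineCoords k hδ).submatrix id δ'.emb)
  change IsUnit ((invariants k D).val _)
  rw [h3]
  exact h2

/-- The ring of invariants is a retract of the localization of `k[X_ij]`. -/
theorem eval_affineCoords {D : Set (RSubset r n)} {δ : RSubset r n} (hδ : δ ∈ D)
    (a : invariants k D) :
    EpimRing.eval D (affineCoords k hδ) (fun _ h => isUnit_det_affineCoords hδ h) a.1 = a := by
  refine Subtype.ext ?_
  have hY : ∀ δ' ∈ D, IsUnit
      (((affineCoords k hδ).map (invariants k D).val).submatrix id δ'.emb).det := by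
    intro δ' hδ'
    have h3 := AlgHom.map_det (invariants k D).val
      ((affineCoords k hδ).submatrix id δ'.emb)
    have h4 := (isUnit_det_affineCoords hδ hδ').map (invariants k D).val
    rw [h3] at h4
    exact h4
  have h1 : ((invariants k D).val.comp (EpimRing.eval D (affineCoords k hδ)
      (fun _ h => isUnit_det_affineCoords hδ h))) = EpimRing.eval D _ hY :=
    EpimRing.hom_ext fun i j => by
      rw [AlgHom.comp_apply, EpimRing.eval_gen, EpimRing.eval_gen]
      rfl
  have h2 : EpimRing.eval D (EpimRing.gen k D) (fun _ h => EpimRing.isUnit_det h) =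
      AlgHom.id k (EpimRing k D) :=
    EpimRing.hom_ext fun i j => by rw [EpimRing.eval_gen]; rfl
  refine (DFunLike.congr_fun h1 a.1).trans ?_
  -- The generic matrix is `(X)_δ` times the matrix of affine coordinates, so `a` has the same value
  -- at both; its value at the generic matrix is `a` itself.
  rw [← eval_mul_of_mem_invariants hY (fun _ h => EpimRing.isUnit_det h) _
    (EpimRing.isUnit_det hδ) (gen_mul_affineCoords hδ).symm, h2]
  rfl

/-- A morphism of algebras on the ring of invariants is determined by the affine coordinates. -/
theorem invariants_hom_ext {D : Set (RSubset r n)} {δ : RSubset r n} (hδ : δ ∈ D)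
    {f g : invariants k D →ₐ[k] B}
    (h : ∀ i j, f (affineCoords k hδ i j) = g (affineCoords k hδ i j)) : f = g := by
  -- The retraction `ρ` onto the invariants reduces the claim to morphisms out of the localized
  -- polynomial ring, which are determined by the images of the variables.
  let ρ := EpimRing.eval (k := k) D (affineCoords k hδ) (fun _ h => isUnit_det_affineCoords hδ h)
  have h1 : f.comp ρ = g.comp ρ := EpimRing.hom_ext fun i j => by
    rw [AlgHom.comp_apply, AlgHom.comp_apply, EpimRing.eval_gen, h]
  refine AlgHom.ext fun a => ?_
  rw [← eval_affineCoords hδ a]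
  exact DFunLike.congr_fun h1 a.1

/-- Evaluation at `A` of the identity `(X)_δ * Y = X`, where `Y` is the matrix of affine
coordinates: the first factor becomes `1`. -/
theorem eval_affineCoords_val {D : Set (RSubset r n)} {δ : RSubset r n} (hδ : δ ∈ D)
    (A : Matrix (Fin r) (Fin n) B) (hA : ∀ δ ∈ D, IsUnit (A.submatrix id δ.emb).det)
    (h1 : A.submatrix id δ.emb = 1) (i : Fin r) (j : Fin n) :
    EpimRing.eval D A hA (affineCoords k hδ i j).1 = A i j := by
  have h2 := congrArg (fun M => M.map (EpimRing.eval (k := k) D A hA)) (gen_mul_affineCoords hδ)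
  have h3 : (EpimRing.gen k D).map (EpimRing.eval D A hA) = A :=
    Matrix.ext fun i j => EpimRing.eval_gen D A hA i j
  simp only [Matrix.map_mul, ← Matrix.submatrix_map, h3, h1, Matrix.one_mul] at h2
  exact congrFun (congrFun h2 i) j

/-- Columns restrict to columns, and coordinates in the basis of the columns of `δ` are unique. -/
theorem res_affineCoords {D D' : Set (RSubset r n)} {δ : RSubset r n} (hδ : δ ∈ D) (h : D ⊆ D')
    (i : Fin r) (j : Fin n) :
    invariants.res k h (affineCoords k hδ i j) = affineCoords k (h hδ) i j := by
  refine congrFun (f := fun i => invariants.res k h (affineCoords k hδ i j))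
    ((column_comb_bijective (h hδ)).1 ?_) i
  refine Eq.trans ?_ (column_comb_affineCoords (h hδ) j).symm
  have h1 := congrArg (equivariantVectors.res k h) (column_comb_affineCoords hδ j)
  rw [map_sum] at h1
  have h2 : ∀ j, equivariantVectors.res k h (column k r D j) = column k r D' j := fun j =>
    Subtype.ext (funext fun i => EpimRing.res_algebraMap h _)
  simpa only [equivariantVectors.res_smul, h2] using h1

end Invariants

open RingedSpaceOver

/-! ### The universal bundle is framed by the affine coordinates. -/

section Universal
variable {k : Type u} [CommRing k] {r n : ℕ}

/-- The value at a point of a function on the grassmannian. -/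
def grassValue {V : Opens (Grass k r n).space} (D : V) : Fn (Grass k r n) V →+* invariants k D.1.parts where
  toFun a := GrassSections.value (k := k) (U := V) a D
  map_one' := rfl
  map_mul' _ _ := rfl
  map_zero' := rfl
  map_add' _ _ := rfl

/-- The value at a point of a section of the universal bundle. -/
def bundleValue {V : Opens (Grass k r n).space} (D : V) :
    Sec (universalBundle k r n) V →+ equivariantVectors k D.1.parts where
  toFun (s : bundleSections k V) := s.1 D
  map_zero' := rfl
  map_add' _ _ := rfl

/-- The function on the grassmannian given by a compatible family of invariants. -/
def grassMk {V : Opens (Grass k r n).space} (a : ∀ D : V, invariants k D.1.parts)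
    (h : ∀ (x y : V) (h : x.1.parts ⊆ y.1.parts), invariants.res k h (a x) = a y) :
    Fn (Grass k r n) V :=
  (⟨a, h⟩ : GrassSections k V)

variable {V W : Opens (Grass k r n).space}

theorem grassValue_ext {a b : Fn (Grass k r n) V} (h : ∀ D : V, grassValue D a = grassValue D b) :
    a = b :=
  Subtype.ext (funext h)

theorem res_grassValue (a : Fn (Grass k r n) V) (x y : V) (h : x.1.parts ⊆ y.1.parts) :
    invariants.res k h (grassValue x a) = grassValue y a :=
  Subtype.property (p := fun s => s ∈ ringSections (grassFunctor k r n) V) a x y h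

theorem bundleValue_ext {s t : Sec (universalBundle k r n) V}
    (h : ∀ D : V, bundleValue D s = bundleValue D t) : s = t :=
  Subtype.ext (funext h)

theorem res_bundleValue (s : Sec (universalBundle k r n) V) (x y : V)
    (h : x.1.parts ⊆ y.1.parts) :
    equivariantVectors.res k h (bundleValue x s) = bundleValue y s :=
  Subtype.property (p := fun s => s ∈ bundleSections (k := k) (r := r) (n := n) V) s x y h

theorem bundleValue_comb {m : ℕ} (f : Fin m → Fin n) (c : Fin m → Fn (Grass k r n) V) (D : V) :
    bundleValue D (Sec.comb (E := universalBundle k r n) (fun i => universalColumn k r n (f i)) c) =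
      ∑ i, grassValue D (c i) • column k r D.1.parts (f i) :=
  map_sum (bundleValue D) _ _

variable (k) in
/-- The coordinates of the columns of the generic matrix in the basis of the columns with indices in
`δ`, as functions on the grassmannian. -/
def universalMatrix (δ : RSubset r n) :
    Matrix (Fin r) (Fin n) (Fn (Grass k r n) (PStar.basicOpen δ)) :=
  fun i j => grassMk (V := PStar.basicOpen δ) (fun D => affineCoords k (δ := δ) D.2 i j)
    fun _ _ h => res_affineCoords _ h i j

variable (k r n) in
-- Each condition is checked at the points `D` of the open subset, where it reduces to
-- `column_comb_bijective` because `δ ∈ D`. The coordinates found at the different points are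
-- compatible by their uniqueness.
theorem universal_isFramed :
    IsFramed (universalBundle k r n) (universalColumn k r n) PStar.basicOpen
      (universalMatrix k) where
  covers D := D.nonempty
  basis δ V hV := by
    constructor
    · intro a b hab
      funext i
      refine grassValue_ext fun D => ?_
      have h := congrArg (bundleValue D) hab
      simp only [bundleValue_comb] at h
      exact congrFun (f := fun i => grassValue D (a i)) (g := fun i => grassValue D (b i))
        ((column_comb_bijective (hV D.2)).1 h) i
    · intro s
      choose a ha using fun D : V => (column_comb_bijective (k := k) (δ := δ) (hV D.2)).2
        (bundleValue D s)
      refine ⟨fun i => grassMk (fun D => a D i) fun x y h => ?_, bundleValue_ext fun D => ?_⟩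
      · refine congrFun (f := fun i => invariants.res k h (a x i)) (g := a y)
          ((column_comb_bijective (k := k) (δ := δ) (hV y.2)).1 ?_) i
        refine Eq.trans ?_ (ha y).symm
        rw [← res_bundleValue s x y h, ← ha x, map_sum]
        refine Finset.sum_congr rfl fun i _ => ?_
        rw [equivariantVectors.res_smul]
        exact congrArg _ (Subtype.ext (funext fun i => (EpimRing.res_algebraMap h _).symm))
      · rw [bundleValue_comb]
        exact ha D
  coord δ j := bundleValue_ext fun D => by
    refine Eq.trans ?_ (bundleValue_comb (V := PStar.basicOpen δ) δ.emb _ D).symm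
    exact (column_comb_affineCoords (k := k) (δ := δ) D.2 j).symm

end Universal

/-! ### Algebra structures on functions and equality of morphisms of ringed spaces. -/

namespace RingedSpaceOver
variable {k : Type u} [CommRing k] {S T : RingedSpaceOver k}

instance (V : Opens S.space) : Algebra k (Fn S V) :=
  ((Fn.res le_top).comp (S.structureMap : k →+* Fn S ⊤)).toAlgebra

/-- The restriction of functions, as a morphism of algebras. -/
def Fn.resₐ {V W : Opens S.space} (h : W ≤ V) : Fn S V →ₐ[k] Fn S W :=
  { Fn.res h with commutes' := fun a => Fn.res_res le_top h (S.structureMap a : Fn S ⊤) }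

/-- The inverse image of functions, as a morphism of algebras. -/
def Fn.comapₐ (h : S ⟶ T) (V : Opens T.space) : Fn T V →ₐ[k] Fn S (preim h V) :=
  { Fn.comap h V with
    commutes' := fun a => by
      have h1 : Fn.comap h ⊤ (T.structureMap a : Fn T ⊤) = S.structureMap a := RingedSpaceOver.Hom.comm h a
      have h2 := Fn.comap_res h (le_top : V ≤ ⊤) (T.structureMap a : Fn T ⊤)
      rw [h1] at h2
      exact h2 }

theorem hom_ext_of_comap {f g : S ⟶ T} (hb : base f = base g)
    (h : ∀ (V : Opens T.space) (a : Fn T V), Fn.comap f V a =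
      Fn.res (le_of_eq (by simp only [preim, hb])) (Fn.comap g V a)) : f = g := by
  obtain ⟨⟨⟨b, c⟩⟩, hf⟩ := f
  obtain ⟨⟨⟨b', c'⟩⟩, hg⟩ := g
  obtain rfl : b = b' := hb
  have : c = c' := by
    ext V a
    exact (h V a).trans (Fn.res_self _ _)
  subst this
  rfl

theorem comap_res_eq_of_comap_eq {f g : S ⟶ T} {V N : Opens T.space} (hN : N ≤ V)
    (hV : preim f V ≤ preim g V) (hN' : preim f N ≤ preim g N) {a : Fn T V}
    (h : Fn.comap f V a = Fn.res hV (Fn.comap g V a)) :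
    Fn.comap f N (Fn.res hN a) = Fn.res hN' (Fn.comap g N (Fn.res hN a)) := by
  rw [Fn.comap_res, Fn.comap_res, h, Fn.res_res, Fn.res_res]

theorem res_comap_eq_of_comap_res_eq {f g : S ⟶ T} {V N : Opens T.space} (hN : N ≤ V)
    (hV : preim f V ≤ preim g V) (hN' : preim f N ≤ preim g N) {a : Fn T V}
    (h : Fn.comap f N (Fn.res hN a) = Fn.res hN' (Fn.comap g N (Fn.res hN a))) :
    Fn.res ((Opens.map (base f)).monotone hN) (Fn.comap f V a) =
      Fn.res ((Opens.map (base f)).monotone hN) (Fn.res hV (Fn.comap g V a)) := by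
  rw [Fn.comap_res, Fn.comap_res, Fn.res_res] at h
  rw [Fn.res_res, h]

end RingedSpaceOver

/-! ### A morphism to the grassmannian is determined by the affine coordinates. -/

section Uniqueness
variable {k : Type u} [CommRing k] {r n : ℕ} {S : RingedSpaceOver k}

/-- The smallest open neighbourhood of a point of the grassmannian. -/
def grassNhd (D : (Grass k r n).space) : Opens (Grass k r n).space where
  carrier := {D' | D.parts ⊆ D'.parts}
  is_open' := (Topology.IsUpperSet.isOpen_iff_isUpperSet (α := PStar.{u} r n)).mpr
    fun _ _ h h' => Set.Subset.trans h' h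

theorem parts_subset_of_mem_grassNhd {D D' : (Grass k r n).space} (h : D' ∈ grassNhd D) :
    D.parts ⊆ D'.parts := h

theorem mem_grassNhd_self (D : (Grass k r n).space) : D ∈ grassNhd D := Set.Subset.refl D.parts

theorem grassNhd_le {D : (Grass k r n).space} {V : Opens (Grass k r n).space} (h : D ∈ V) :
    grassNhd D ≤ V := fun _ h' =>
  (Topology.IsUpperSet.isOpen_iff_isUpperSet (α := PStar.{u} r n)).mp V.isOpen
    (parts_subset_of_mem_grassNhd h') h

/-- The function defined by an invariant on the smallest open neighbourhood of a point. -/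
def grassExtend (D : (Grass k r n).space) :
    invariants k D.parts →ₐ[k] Fn (Grass k r n) (grassNhd D) where
  toFun a := grassMk (V := grassNhd D) (fun D' => invariants.res k (parts_subset_of_mem_grassNhd D'.2) a) fun x y h => by
    have := congrArg (fun f => f.hom a) ((grassFunctor k r n).map_comp
      (X := D) (Y := x.1) (Z := y.1)
      (homOfLE (parts_subset_of_mem_grassNhd x.2)) (homOfLE h))
    exact this.symm
  map_one' := grassValue_ext fun D' => map_one (invariants.res k (parts_subset_of_mem_grassNhd D'.2))
  map_mul' a b := grassValue_ext fun D' => map_mul (invariants.res k (parts_subset_of_mem_grassNhd D'.2)) a b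
  map_zero' := grassValue_ext fun D' => map_zero (invariants.res k (parts_subset_of_mem_grassNhd D'.2))
  map_add' a b := grassValue_ext fun D' => map_add (invariants.res k (parts_subset_of_mem_grassNhd D'.2)) a b
  commutes' a := grassValue_ext fun D' => (invariants.res k (parts_subset_of_mem_grassNhd D'.2)).commutes a

/-- On the smallest neighbourhood of `D` a compatible family is determined by its value at `D`, so
functions there can be handled as elements of one ring of invariants. -/
theorem grassExtend_value {V : Opens (Grass k r n).space} (D : V) (a : Fn (Grass k r n) V) :
    grassExtend D.1 (grassValue D a) = Fn.res (grassNhd_le D.2) a :=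
  grassValue_ext fun D' => res_grassValue a D ⟨D'.1, grassNhd_le D.2 D'.2⟩
    (parts_subset_of_mem_grassNhd D'.2)

/-- A morphism to the grassmannian is determined by the open subsets `h⁻¹ U_δ` and by the inverse
images of the affine coordinates. -/
theorem hom_grass_ext {f g : S ⟶ Grass k r n}
    (hU : ∀ δ, preim f (PStar.basicOpen δ) = preim g (PStar.basicOpen δ))
    (h : ∀ δ i j, Fn.comap f _ (universalMatrix k δ i j) =
      Fn.res (hU δ).le (Fn.comap g _ (universalMatrix k δ i j))) : f = g := by
  have hb : base f = base g := by
    -- The image of `x` is the set of the `δ` such that `x` lies in the inverse image of `U_δ`, so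
    -- these inverse images determine the continuous map.
    ext x
    refine PStar.ext (Set.ext fun δ => ?_)
    exact SetLike.ext_iff.mp (hU δ) x
  have hV : ∀ V, preim f V = preim g V := fun V => by simp only [preim, hb]
  refine hom_ext_of_comap hb fun V a => Fn.eq_of_locally fun x hx => ?_
  let D : V := ⟨base f x, hx⟩
  refine ⟨preim f (grassNhd D.1), mem_grassNhd_self D.1,
    (Opens.map (base f)).monotone (grassNhd_le D.2), ?_⟩
  -- Over the smallest neighbourhood of the image of `x`, both morphisms become algebra
  -- homomorphisms on the invariants at that point, where `invariants_hom_ext` applies.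
  let F : invariants k D.1.parts →ₐ[k] Fn S (preim f (grassNhd D.1)) :=
    (Fn.comapₐ f _).comp (grassExtend D.1)
  let G : invariants k D.1.parts →ₐ[k] Fn S (preim f (grassNhd D.1)) :=
    (Fn.resₐ (hV _).le).comp ((Fn.comapₐ g _).comp (grassExtend D.1))
  obtain ⟨δ, hδ⟩ := D.1.nonempty
  have hFG : F = G := invariants_hom_ext hδ fun i j => by
    have h1 : grassExtend D.1 (affineCoords k hδ i j) =
        Fn.res (grassNhd_le (V := PStar.basicOpen δ) hδ) (universalMatrix k δ i j) :=
      grassExtend_value (V := PStar.basicOpen δ) ⟨D.1, hδ⟩ (universalMatrix k δ i j)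
    change Fn.comap f _ (grassExtend D.1 (affineCoords k hδ i j)) =
      Fn.res _ (Fn.comap g _ (grassExtend D.1 (affineCoords k hδ i j)))
    rw [h1]
    exact comap_res_eq_of_comap_eq _ _ _ (h δ i j)
  have h2 : Fn.comap f _ (grassExtend D.1 (grassValue D a)) =
      Fn.res (hV _).le (Fn.comap g _ (grassExtend D.1 (grassValue D a))) :=
    DFunLike.congr_fun hFG (grassValue D a)
  rw [grassExtend_value] at h2
  exact res_comap_eq_of_comap_res_eq _ (hV V).le _ h2

end Uniqueness

/-! ### The classifying morphism of a framing. -/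

namespace RingedSpaceOver
section Existence
variable {k : Type u} [CommRing k] {r n : ℕ} {S : RingedSpaceOver k} {E : S.Modules}
  {φ : Fin n → Sec E ⊤} {U : RSubset r n → Opens S.space}
  {A : ∀ δ, Matrix (Fin r) (Fin n) (Fn S (U δ))}

/-- There are finitely many `δ`. On such a `W` the set `{δ | y ∈ U_δ}` contains the one attached to
`x`; this gives the continuity of the classifying map and the open sets on which invariants are
evaluated. -/
theorem exists_nhd_le_of_mem (U : RSubset r n → Opens S.space) (x : S.space) :
    ∃ W : Opens S.space, x ∈ W ∧ ∀ δ, x ∈ U δ → W ≤ U δ := by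
  refine ⟨(Set.toFinite {δ | x ∈ U δ}).toFinset.inf U, ?_, fun δ hδ =>
    Finset.inf_le ((Set.Finite.mem_toFinset _).mpr hδ)⟩
  rw [← SetLike.mem_coe, Opens.coe_finset_inf]
  simp

/-- The columns with index in `δ` of the cocycle relation give `1 = (A_δ)_δ' * (A_δ')_δ`. -/
theorem IsFramed.isUnit_det (hE : IsFramed E φ U A) {δ δ' : RSubset r n} {W : Opens S.space}
    (h : W ≤ U δ) (h' : W ≤ U δ') :
    IsUnit (((A δ).map (Fn.res h)).submatrix id δ'.emb).det := by
  have h1 := congrArg (fun M => (M.submatrix id δ.emb).det) (hE.cocycle δ δ' h h')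
  change _ = (((A δ).map (Fn.res h)).submatrix id δ'.emb *
    ((A δ').map (Fn.res h')).submatrix id δ.emb).det at h1
  simp only [Matrix.submatrix_map, hE.submatrix_self, Matrix.map_one _ (map_zero _) (map_one _),
    Matrix.det_one, Matrix.det_mul] at h1
  exact IsUnit.of_mul_eq_one _ h1.symm

/-- The evaluation of the elements of a localization of `k[X_ij]` at the matrix `A_δ`. -/
def IsFramed.localEval (hE : IsFramed E φ U A) {D : Set (RSubset r n)} {δ : RSubset r n}
    (hδ : δ ∈ D) {W : Opens S.space} (hW : ∀ δ ∈ D, W ≤ U δ) : EpimRing k D →ₐ[k] Fn S W :=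
  EpimRing.eval D ((A δ).map (Fn.res (hW δ hδ))) fun δ' h => hE.isUnit_det _ (hW δ' h)

variable (hE : IsFramed E φ U A) {D : Set (RSubset r n)} {δ δ' : RSubset r n} {W : Opens S.space}

include hE in
-- By the cocycle relation `A_δ` is an invertible matrix times `A_δ'`. Here the `GL_r`-invariance of
-- `a` is used.
theorem IsFramed.localEval_eq (hδ : δ ∈ D) (hδ' : δ' ∈ D) (hW : ∀ δ ∈ D, W ≤ U δ)
    (a : invariants k D) : hE.localEval hδ hW a.1 = hE.localEval hδ' hW a.1 :=
  eval_mul_of_mem_invariants _ _ _ (hE.isUnit_det (hW δ hδ) (hW δ' hδ'))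
    (hE.cocycle δ δ' (hW δ hδ) (hW δ' hδ')) a

theorem IsFramed.localEval_gen (hδ : δ ∈ D) (hW : ∀ δ ∈ D, W ≤ U δ) (i : Fin r) (j : Fin n) :
    hE.localEval hδ hW (EpimRing.gen k D i j) = Fn.res (hW δ hδ) (A δ i j) :=
  EpimRing.eval_gen _ _ _ i j

theorem IsFramed.res_localEval (hδ : δ ∈ D) (hW : ∀ δ ∈ D, W ≤ U δ) {W' : Opens S.space}
    (h : W' ≤ W) (a : EpimRing k D) :
    Fn.res h (hE.localEval hδ hW a) = hE.localEval hδ (fun δ hδ => h.trans (hW δ hδ)) a := by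
  refine DFunLike.congr_fun (f := (Fn.resₐ h).comp (hE.localEval hδ hW))
    (EpimRing.hom_ext fun i j => ?_) a
  refine (congrArg (Fn.res h) (hE.localEval_gen hδ hW i j)).trans ?_
  exact (Fn.res_res _ _ _).trans (hE.localEval_gen hδ (fun δ hδ => h.trans (hW δ hδ)) i j).symm

theorem IsFramed.localEval_res {D' : Set (RSubset r n)} (h : D ⊆ D') (hδ : δ ∈ D)
    (hW : ∀ δ ∈ D', W ≤ U δ) (a : EpimRing k D) :
    hE.localEval (h hδ) hW (EpimRing.res k h a) =
      hE.localEval hδ (fun δ hδ => hW δ (h hδ)) a := by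
  refine DFunLike.congr_fun (f := (hE.localEval (h hδ) hW).comp (EpimRing.res k h))
    (EpimRing.hom_ext fun i j => ?_) a
  refine (congrArg (hE.localEval (h hδ) hW) (EpimRing.res_algebraMap h _)).trans ?_
  exact (hE.localEval_gen (h hδ) hW i j).trans
    (hE.localEval_gen hδ (fun δ hδ => hW δ (h hδ)) i j).symm

theorem IsFramed.localEval_affineCoords (hδ : δ ∈ D) (hW : ∀ δ ∈ D, W ≤ U δ) (i : Fin r)
    (j : Fin n) : hE.localEval hδ hW (affineCoords k hδ i j).1 = Fn.res (hW δ hδ) (A δ i j) :=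
  eval_affineCoords_val hδ _ _ (by
    rw [Matrix.submatrix_map, hE.submatrix_self, Matrix.map_one _ (map_zero _) (map_one _)]) i j

/-- The continuous map to the grassmannian defined by the covering. -/
def IsFramed.classifyingBase : S.space ⟶ (Grass k r n).space :=
  TopCat.ofHom (X := S.space) (Y := PStar.{u} r n)
    { toFun := fun x => ⟨{δ | x ∈ U δ}, hE.covers x⟩
      continuous_toFun := by
        refine continuous_def.mpr fun V hV => isOpen_iff_forall_mem_open.mpr fun x hx => ?_
        obtain ⟨W, hxW, hW⟩ := exists_nhd_le_of_mem U x
        refine ⟨W, fun y hy => ?_, W.isOpen, hxW⟩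
        -- The image of `y` lies above the image of `x`, and `V` is an upper set.
        refine Topology.IsUpperSet.isOpen_iff_isUpperSet.mp hV ?_ hx
        exact fun δ hδ => hW δ hδ hy }

/-- The set of `r`-subsets that corresponds to a point of the grassmannian. -/
def grassParts (D : (Grass k r n).space) : Set (RSubset r n) := PStar.parts D

theorem IsFramed.mem_grassParts_classifyingBase (x : S.space) :
    δ ∈ grassParts (hE.classifyingBase x) ↔ x ∈ U δ := Iff.rfl

variable {V : Opens (Grass k r n).space} {D D' : V}

/-- The evaluation at the matrix `A_δ` of the value at a point of a function on the grassmannian. -/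
def IsFramed.localValue (hδ : δ ∈ grassParts D.1) (hW : ∀ δ ∈ grassParts D.1, W ≤ U δ) :
    Fn (Grass k r n) V →+* Fn S W :=
  ((hE.localEval hδ hW).comp (invariants k (grassParts D.1)).val).toRingHom.comp (grassValue D)

theorem IsFramed.res_localValue (hδ : δ ∈ grassParts D.1) (hW : ∀ δ ∈ grassParts D.1, W ≤ U δ)
    {W' : Opens S.space} (h : W' ≤ W) (s : Fn (Grass k r n) V) :
    Fn.res h (hE.localValue hδ hW s) = hE.localValue hδ (fun δ hδ => h.trans (hW δ hδ)) s :=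
  hE.res_localEval hδ hW h _

/-- The value of `s` at `D'` is the restriction of its value at `D`, and evaluation commutes with
this restriction; then `δ` is exchanged for `δ'` by `localEval_eq` at `D'`. -/
theorem IsFramed.localValue_eq (hD : grassParts D.1 ⊆ grassParts D'.1)
    (hδ : δ ∈ grassParts D.1) (hδ' : δ' ∈ grassParts D'.1) (hW : ∀ δ ∈ grassParts D.1, W ≤ U δ)
    (hW' : ∀ δ ∈ grassParts D'.1, W ≤ U δ) (s : Fn (Grass k r n) V) :
    hE.localValue hδ hW s = hE.localValue hδ' hW' s := by
  have h1 := hE.localEval_res hD hδ hW' (grassValue D s).1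
  have h2 := hE.localEval_eq hδ' (hD hδ) hW' (grassValue D' s)
  have h3 := congrArg (fun a : invariants k (grassParts D'.1) => hE.localEval (hD hδ) hW' a.1)
    (res_grassValue s D D' hD)
  exact h1.symm.trans (h3.trans h2.symm)

/-- A function on the inverse image of an open subset of the grassmannian is the lift of a function
on it if it is locally obtained by evaluation. -/
def IsFramed.IsLift (s : Fn (Grass k r n) V)
    (t : Fn S ((Opens.map hE.classifyingBase).obj V)) : Prop :=
  ∀ (D : V) (δ : RSubset r n) (hδ : δ ∈ grassParts D.1) (W : Opens S.space)
    (hW : W ≤ (Opens.map hE.classifyingBase).obj V) (hW' : ∀ δ ∈ grassParts D.1, W ≤ U δ),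
    Fn.res hW t = hE.localValue hδ hW' s

variable {hE}

theorem IsFramed.IsLift.unique {s : Fn (Grass k r n) V}
    {t t' : Fn S ((Opens.map hE.classifyingBase).obj V)} (h : hE.IsLift s t) (h' : hE.IsLift s t') :
    t = t' := by
  refine Fn.eq_of_locally fun x hx => ?_
  obtain ⟨W, hxW, hW⟩ := exists_nhd_le_of_mem U x
  obtain ⟨δ, hδ⟩ := hE.covers x
  refine ⟨W ⊓ (Opens.map hE.classifyingBase).obj V, ⟨hxW, hx⟩, inf_le_right, ?_⟩
  exact (h ⟨_, hx⟩ δ hδ _ inf_le_right fun δ hδ => inf_le_left.trans (hW δ hδ)).trans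
    (h' ⟨_, hx⟩ δ hδ _ inf_le_right fun δ hδ => inf_le_left.trans (hW δ hδ)).symm

/-- Near `x` the value of `s` at the image `D` of `x` is evaluated at `A_δ` for a chosen `δ ∈ D`.
Near a point `z` of an overlap, both evaluations agree with the one made at the image of `z`, which
lies above the images of `x` and `y`. -/
theorem IsFramed.exists_isLift (hE : IsFramed E φ U A) (s : Fn (Grass k r n) V) :
    ∃ t, hE.IsLift s t := by
  let V' := (Opens.map hE.classifyingBase).obj V
  choose W hxW hW using exists_nhd_le_of_mem U
  choose d hd using hE.covers
  let D : V' → V := fun x => ⟨hE.classifyingBase x.1, x.2⟩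
  have hW' : ∀ x : V', ∀ δ ∈ grassParts (D x).1, V' ⊓ W x.1 ≤ U δ := fun x δ hδ =>
    inf_le_right.trans (hW x.1 δ hδ)
  have hd' : ∀ x : V', d x.1 ∈ grassParts (D x).1 := fun x => hd x.1
  obtain ⟨t, ht⟩ := Fn.exists_glue (fun x : V' => V' ⊓ W x.1) (fun x => inf_le_left)
    (fun x hx => ⟨⟨x, hx⟩, hx, hxW x⟩)
    (fun x => hE.localValue (D := D x) (hd' x) (hW' x) s)
    (fun x y => by
      refine Fn.eq_of_locally fun z hz => ?_
      have hz' : z ∈ V' := hz.1.1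
      refine ⟨((V' ⊓ W x.1) ⊓ (V' ⊓ W y.1)) ⊓ W z, ⟨hz, hxW z⟩, inf_le_left, ?_⟩
      rw [hE.res_localValue, hE.res_localValue, hE.res_localValue, hE.res_localValue]
      refine (hE.localValue_eq (D' := D ⟨z, hz'⟩) ?_ _ (hd' ⟨z, hz'⟩) _
        (fun δ hδ => inf_le_right.trans (hW z δ hδ)) s).trans
        (hE.localValue_eq (D' := D ⟨z, hz'⟩) ?_ _ (hd' ⟨z, hz'⟩) _
        (fun δ hδ => inf_le_right.trans (hW z δ hδ)) s).symm
      · exact fun δ hδ => hW' x δ hδ hz.1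
      · exact fun δ hδ => hW' y δ hδ hz.2)
  -- For an arbitrary `D₀`, the same comparison at a point `y` of `W₀`: the image of `y` contains
  -- `D₀` because `W₀ ≤ U_δ` for all `δ ∈ D₀`.
  refine ⟨t, fun D₀ δ hδ W₀ hW₀ hW₀' => Fn.eq_of_locally fun y hy => ?_⟩
  refine ⟨W₀ ⊓ W y, ⟨hy, hxW y⟩, inf_le_left, ?_⟩
  have h1 := congrArg (Fn.res (le_inf (inf_le_left.trans hW₀) inf_le_right :
    W₀ ⊓ W y ≤ V' ⊓ W y)) (ht ⟨y, hW₀ hy⟩)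
  rw [Fn.res_res, hE.res_localValue] at h1
  rw [Fn.res_res, hE.res_localValue]
  refine h1.trans (hE.localValue_eq (D' := D ⟨y, hW₀ hy⟩) ?_ _ (hd' ⟨y, hW₀ hy⟩) _ _ s).symm
  exact fun δ hδ => hW₀' δ hδ hy

variable (hE)

/-- The lift of a function on the grassmannian. -/
def IsFramed.lift (V : Opens (Grass k r n).space) :
    Fn (Grass k r n) V →+* Fn S ((Opens.map hE.classifyingBase).obj V) where
  toFun s := (hE.exists_isLift s).choose
  -- Lifts are unique and every `localValue` is a ring homomorphism, so the lifts respect the ring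
  -- operations.
  map_one' := (hE.exists_isLift 1).choose_spec.unique fun D δ hδ W hW hW' =>
    (map_one (Fn.res hW)).trans (map_one (hE.localValue hδ hW')).symm
  map_zero' := (hE.exists_isLift 0).choose_spec.unique fun D δ hδ W hW hW' =>
    (map_zero (Fn.res hW)).trans (map_zero (hE.localValue hδ hW')).symm
  map_mul' s s' := (hE.exists_isLift (s * s')).choose_spec.unique fun D δ hδ W hW hW' => by
    rw [map_mul, (hE.exists_isLift s).choose_spec D δ hδ W hW hW',
      (hE.exists_isLift s').choose_spec D δ hδ W hW hW', ← map_mul]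
  map_add' s s' := (hE.exists_isLift (s + s')).choose_spec.unique fun D δ hδ W hW hW' => by
    rw [map_add, (hE.exists_isLift s).choose_spec D δ hδ W hW hW',
      (hE.exists_isLift s').choose_spec D δ hδ W hW hW', ← map_add]

theorem IsFramed.isLift_lift (s : Fn (Grass k r n) V) : hE.IsLift s (hE.lift V s) :=
  (hE.exists_isLift s).choose_spec

theorem IsFramed.lift_res {V' : Opens (Grass k r n).space} (h : V' ≤ V) (s : Fn (Grass k r n) V) :
    hE.lift V' (Fn.res h s) =
      Fn.res ((Opens.map hE.classifyingBase).monotone h) (hE.lift V s) :=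
  (hE.isLift_lift (Fn.res h s)).unique fun D δ hδ W hW hW' => by
    rw [Fn.res_res]
    exact hE.isLift_lift s ⟨D.1, h D.2⟩ δ hδ W _ hW'

/-- The morphism to the grassmannian defined by a framing. -/
def IsFramed.classifyingMap : S ⟶ Grass k r n where
  hom := InducedCategory.homMk
    { base := hE.classifyingBase
      c :=
        { app := fun V => CommRingCat.ofHom (hE.lift V.unop)
          naturality := fun V V' i => by
            ext s
            exact hE.lift_res i.unop.le s } }
  -- Evaluations are morphisms of `k`-algebras, so a constant is the lift of the same constant.
  comm a := (hE.isLift_lift (V := ⊤) ((Grass k r n).structureMap a)).unique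
    fun D δ hδ W hW hW' => ((hE.localEval hδ hW').commutes a).symm

theorem IsFramed.preim_classifyingMap (δ : RSubset r n) :
    preim hE.classifyingMap (PStar.basicOpen δ) = U δ :=
  Opens.ext (Set.ext fun x => hE.mem_grassParts_classifyingBase x)

/-- Near a point of `U_δ` the evaluation can be made at `A_δ`, whose columns in `δ` are those of the
identity; the affine coordinates for `δ` are then sent to the entries of `A_δ`. -/
theorem IsFramed.comap_classifyingMap (δ : RSubset r n) (i : Fin r) (j : Fin n) :
    Fn.comap hE.classifyingMap (PStar.basicOpen δ) (universalMatrix k δ i j) =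
      Fn.res (hE.preim_classifyingMap δ).le (A δ i j) := by
  refine Fn.eq_of_locally fun x hx => ?_
  obtain ⟨W, hxW, hW⟩ := exists_nhd_le_of_mem U x
  have hWU : W ≤ U δ := hW δ hx
  have hWU' : W ≤ preim hE.classifyingMap (PStar.basicOpen δ) :=
    hWU.trans (hE.preim_classifyingMap δ).ge
  refine ⟨W, hxW, hWU', ?_⟩
  have h1 := hE.isLift_lift (V := PStar.basicOpen δ) (universalMatrix k δ i j)
    ⟨hE.classifyingBase x, hx⟩ δ hx W hWU' hW
  refine h1.trans (Eq.trans ?_ (Fn.res_res _ _ _).symm)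
  exact hE.localEval_affineCoords (D := {δ | x ∈ U δ}) hx hW i j

end Existence
end RingedSpaceOver

/-! ### Representability. -/

namespace RingedSpaceOver
variable {k : Type u} [CommRing k] {r n : ℕ} {S : RingedSpaceOver k} {E : S.Modules}
  {φ : Fin n → Sec E ⊤} {U U' : RSubset r n → Opens S.space}
  {A : ∀ δ, Matrix (Fin r) (Fin n) (Fn S (U δ))}

/-- The entries of the matrices lie in rings that depend on the covering, so equal coverings are
compared by restriction of functions. -/
theorem IsFramed.congr_cover (hE : IsFramed E φ U A) (hU : ∀ δ, U' δ = U δ) :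
    IsFramed E φ U' (fun δ => (A δ).map (Fn.res (hU δ).le)) := by
  obtain rfl : U' = U := funext hU
  convert hE using 2 with δ
  ext i j
  exact Fn.res_self _ _

end RingedSpaceOver

namespace QuotientDatum
variable {k : Type u} [CommRing k] {r n : ℕ} {S T : RingedSpaceOver k}

theorem equivalent_of_isFramed {θ θ' : QuotientDatum r n S}
    {A : ∀ δ, Matrix (Fin r) (Fin n) (Fn S (θ.U δ))} (hU : θ.U = θ'.U)
    (h : IsFramed θ.E θ.φ θ.U A) (h' : IsFramed θ'.E θ'.φ θ.U A) : Equivalent θ θ' := by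
  obtain ⟨ψ, hψ⟩ := h.exists_iso h'
  exact ⟨hU, ψ, hψ⟩

theorem IsAlgTopQuotient.pullback {θ : QuotientDatum r n T} (hθ : θ.IsAlgTopQuotient)
    (h : S ⟶ T) : (θ.pullback h).IsAlgTopQuotient := by
  obtain ⟨A, hA⟩ := hθ.exists_isFramed
  exact isAlgTopQuotient_of_isFramed (θ := θ.pullback h) (hA.pullback h)

variable (k r n) in
theorem universal_isAlgTopQuotient : (universalQuotient k r n).IsAlgTopQuotient :=
  isAlgTopQuotient_of_isFramed (θ := universalQuotient k r n) (universal_isFramed k r n)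

/-- The inverse image of `u` along the classifying morphism is framed by the inverse images of the
universal matrices. These are the matrices of `θ`, and sheaves with the same framing are isomorphic.
-/
theorem IsAlgTopQuotient.exists_classifyingMap {θ : QuotientDatum r n S}
    (hθ : θ.IsAlgTopQuotient) :
    ∃ h : S ⟶ Grass k r n, Equivalent ((universalQuotient k r n).pullback h) θ := by
  obtain ⟨A, hA⟩ := hθ.exists_isFramed
  have h := (universal_isFramed k r n).pullback hA.classifyingMap
  have hAB : (fun δ => (universalMatrix k δ).map (Fn.comap hA.classifyingMap _)) =
      fun δ => (A δ).map (Fn.res (hA.preim_classifyingMap δ).le) :=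
    funext fun δ => Matrix.ext fun i j => hA.comap_classifyingMap δ i j
  rw [hAB] at h
  exact ⟨hA.classifyingMap, equivalent_of_isFramed
    (θ := (universalQuotient k r n).pullback hA.classifyingMap)
    (funext hA.preim_classifyingMap) h (hA.congr_cover hA.preim_classifyingMap)⟩

/-- An equivalence transports the framing of one inverse image to the other; the matrices of a
framing being unique, `f` and `g` pull back the affine coordinates to the same functions, and
`hom_grass_ext` applies. -/
theorem eq_of_equivalent_pullback {f g : S ⟶ Grass k r n}
    (h : Equivalent ((universalQuotient k r n).pullback f)
      ((universalQuotient k r n).pullback g)) : f = g := by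
  obtain ⟨hU, ψ, hψ⟩ := h
  have hU' : ∀ δ, preim f (PStar.basicOpen δ) = preim g (PStar.basicOpen δ) := congrFun hU
  have h1 := ((universal_isFramed k r n).pullback f).of_iso ψ hψ
  have h2 := ((universal_isFramed k r n).pullback g).congr_cover hU'
  have h3 := h1.matrix_unique h2
  exact hom_grass_ext hU' fun δ i j => congrFun (congrFun (congrFun h3 δ) i) j

end QuotientDatum

section Functor
variable (k : Type u) [CommRing k] (r n : ℕ)

/-- The functor of algebro-topological quotients of rank `r` of the free module of rank `n`. -/
def algTopQuotientFunctor : Subfunctor (datumFunctor k r n) where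
  obj S := {c | ∃ θ : QuotientDatum r n S.unop, θ.IsAlgTopQuotient ∧ Quotient.mk _ θ = c}
  map h := by
    rintro _ ⟨θ, hθ, rfl⟩
    exact ⟨θ.pullback h.unop, hθ.pullback h.unop, rfl⟩

/-- The class of the inverse image of the universal quotient. -/
def pullbackUniversal (S : RingedSpaceOver k) (h : S ⟶ Grass k r n) :
    (algTopQuotientFunctor k r n).obj (op S) :=
  ⟨Quotient.mk _ ((universalQuotient k r n).pullback h), _,
    (QuotientDatum.universal_isAlgTopQuotient k r n).pullback h, rfl⟩

theorem pullbackUniversal_bijective (S : RingedSpaceOver k) :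
    Function.Bijective (pullbackUniversal k r n S) := by
  constructor
  · intro f g h
    exact QuotientDatum.eq_of_equivalent_pullback (Quotient.exact (congrArg Subtype.val h))
  · rintro ⟨_, θ, hθ, rfl⟩
    obtain ⟨h, hh⟩ := hθ.exists_classifyingMap
    exact ⟨h, Subtype.ext (Quotient.sound hh)⟩

/-- The grassmannian represents the functor of algebro-topological quotients. -/
def grassRepresentableBy :
    (algTopQuotientFunctor k r n).toFunctor.RepresentableBy (Grass k r n) where
  homEquiv {S} := Equiv.ofBijective _ (pullbackUniversal_bijective k r n S)
  homEquiv_comp f g := Subtype.ext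
    (Quotient.sound (QuotientDatum.pullback_comp f g (universalQuotient k r n)))

end Functor

end GrassRS

end

theorem mainTheorem1 (k : Type u) [CommRing k] (r n : ℕ) :
    ∃ F : Subfunctor (datumFunctor k r n),
      (∀ S : RingedSpaceOver k, F.obj (op S) =
        {c | ∃ θ : QuotientDatum r n S, θ.IsAlgTopQuotient ∧ Quotient.mk _ θ = c}) ∧
      ∃ e : F.toFunctor.RepresentableBy (Grass k r n),
        (e.homEquiv (𝟙 (Grass k r n))).1 = Quotient.mk _ (universalQuotient k r n) :=
  ⟨algTopQuotientFunctor k r n, fun _ => rfl, grassRepresentableBy k r n,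
    Quotient.sound (QuotientDatum.pullback_id (universalQuotient k r n))⟩
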